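/- **Setting.** Let $\Lambda\subset\mathbb R^2$ be a unimodular lattice and $R>0$ such that the closed horizontal slits $\lambda+[-R,R]\times\{0\}$, $\lambda\in\Lambda$, are pairwise disjoint. A *vertical light ray* in $F(\Lambda,R)$ moves vertically with unit speed; whenever it hits the interior of the slit centred at $\lambda$, it is rotated by $\pi$ about $\lambda$ (it jumps from $z$ to $2\lambda-z$) and continues vertically in the opposite direction; it passes straight through the ends of slits. Rays are followed for all times in $\mathbb R$. Let $\gamma_+=(x_+,y_+)$, $\gamma_-=(x_-,y_-)$ be any basis of $\Lambda$ with $x_+>0$, $y_+\ge 0$, $x_-\le 0$, $y_->0$ such that $[-R,R]\times\{0\}$ lies in the interior of the parallelogram $P=[-\tfrac12,\tfrac12)\gamma_++[-\tfrac12,\tfrac12)\gamma_-$. Let $F_+$, $F_-$ be two copies of the plane cut along all slits, the first for upward and the second for downward motion. Gluing, for every $\lambda\in\Lambda$, the upper (lower) edge of the slit centred at $\lambda$ in $F_+$ to the upper (lower) edge of the slit centred at $\lambda$ in $F_-$ by $\lambda+u\mapsto\lambda-u$ gives a surface $\widetilde M$. It carries the translation structure given by $dz$ on $F_+$ and by $-dz$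 on $F_-$ (that is, by $dz$ after rotating $F_-$ by $\pi$). $\Lambda$ acts on $\widetilde M$ by translating both copies, and $p:\widetilde M\to M=M(\Lambda,R)=\widetilde M/\Lambda$ is the quotient map onto a compact translation surface $(M,\omega)$, whose singular points come from the ends of the slits. Let $\varphi^v_t$ be its unit speed vertical flow, and $M^+_\omega$ the set of points $x$ for which $\varphi^v_t(x)$ is defined for all $t\ge 0$ without meeting a singular point. Let $D\subset\widetilde M$ be the fundamental domain consisting of the parts of both copies over $P$. For $x\in M_\omega^+$ and $t>0$ let $\sigma_t(x)\in H_1(M,\mathbb Z)$ be the class of the loop formed by the vertical orbit segment from $x$ to $\varphi^v_t(x)$, closed up by the image under $p$ of a curve inside $D$. Let $\gamma_\pm^+$ and $\gamma_\pm^-$ be the sides of the parallelogram $P$, oriented as the vectors $\gamma_\pm$, in the copies $F_+$ and $F_-$ respectively; their images in $M$ are loops. Put $\gamma_1=[p(\gamma_+^+)]+[p(\gamma_+^-)]$ and $\gamma_2=[p(\gamma_-^+)]+[p(\gamma_-^-)]$, and let $\langle\cdot,\cdot\rangle$ be the algebraic intersection form on $H_1(M,\mathbb R)$. **Theorem.**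 Suppose that $M(\Lambda,R)$ has no vertical saddle connection, i.e. no vertical orbit segment connects singular points. Let $0\ne\xi\in\mathbb R\gamma_1+\mathbb R\gamma_2\subset H_1(M,\mathbb R)$ and $C>0$ be such that $$|\langle\sigma_t(x),\xi\rangle|\le C\qquad\text{for all }x\in M^+_\omega\text{ and }t>0 .$$ Then the vector $\bar v=\langle\gamma_2,\xi\rangle\gamma_+-\langle\gamma_1,\xi\rangle\gamma_-$ is non-zero, and there exists $\overline C>0$ such that every vertical light ray in $F(\Lambda,R)$ is contained in an infinite band in direction $\bar v$ of width at most $\overline C$. -/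

import Mathlib

noncomputable section

/-! ### First singular homology: classes of loops and winding numbers -/

section Homology

open CategoryTheory AlgebraicTopology Simplicial

variable {X : Type} [TopologicalSpace X]

/-- The first singular homology group `H₁(X; ℝ)`. -/
abbrev H1 (X : Type) [TopologicalSpace X] : ModuleCat.{0} ℝ :=
  ((singularHomologyFunctor (ModuleCat.{0} ℝ) 1).obj (ModuleCat.of ℝ ℝ)).obj (TopCat.of X)

/-- The singular simplicial set of `X`. -/
abbrev Sing (X : Type) [TopologicalSpace X] : SSet.{0} := TopCat.toSSet.obj (TopCat.of X)

/-- A singular `n`-simplex of `X` as a continuous map on the standard `n`-simplex. -/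
def simplexMap {n : ℕ} (σ : (Sing X) _⦋n⦌) : C(stdSimplex ℝ (Fin (n + 1)), X) :=
  TopCat.toSSetObjEquiv (TopCat.of X) (.op ⦋n⦌) σ

/-- A path, regarded as a singular `1`-simplex. -/
def pathSimplex {x y : X} (γ : Path x y) : (Sing X) _⦋1⦌ :=
  (TopCat.toSSetObjEquiv (TopCat.of X) (.op ⦋1⦌)).symm
    (γ.toContinuousMap.comp (stdSimplexHomeomorphUnitInterval : C(stdSimplex ℝ (Fin 2), unitInterval)))

theorem simplexMap_pathSimplex {x y : X} (γ : Path x y) (v : stdSimplex ℝ (Fin 2)) :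
    simplexMap (pathSimplex γ) v = γ (stdSimplexHomeomorphUnitInterval v) := by
  simp only [simplexMap, pathSimplex, Equiv.apply_symm_apply]
  rfl

theorem simplexMap_δ {n : ℕ} (τ : (Sing X) _⦋n + 1⦌) (i : Fin (n + 2))
    (v : stdSimplex ℝ (Fin (n + 1))) :
    simplexMap ((Sing X).δ i τ) v = simplexMap τ (stdSimplex.map i.succAbove v) := rfl

/-- The singular chain complex of `X` with real coefficients. -/
abbrev SC (X : Type) [TopologicalSpace X] : ChainComplex (ModuleCat.{0} ℝ) ℕ :=
  (Sing X).chainComplex (ModuleCat.of ℝ ℝ)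

theorem simplex_zero_ext {σ σ' : (Sing X) _⦋0⦌}
    (h : simplexMap σ (stdSimplex.vertex 0) = simplexMap σ' (stdSimplex.vertex 0)) : σ = σ' := by
  apply (TopCat.toSSetObjEquiv (TopCat.of X) (.op ⦋0⦌)).injective
  ext v
  have : v = stdSimplex.vertex (S := ℝ) (X := Fin 1) 0 := Subsingleton.elim _ _
  rw [this]
  exact h

theorem path_chain_d {x : X} (γ : Path x x) :
    (Sing X).ιChainComplex (R := ModuleCat.of ℝ ℝ) (pathSimplex γ) ≫ (SC X).d 1 0 = 0 := by
  have h : (Sing X).δ 0 (pathSimplex γ) = (Sing X).δ 1 (pathSimplex γ) := by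
    apply simplex_zero_ext
    rw [simplexMap_δ, simplexMap_δ, stdSimplex.map_vertex, stdSimplex.map_vertex,
      simplexMap_pathSimplex, simplexMap_pathSimplex]
    have h1 : stdSimplexHomeomorphUnitInterval (stdSimplex.vertex (Fin.succAbove 0 (0 : Fin 1)))
        = 1 := stdSimplexHomeomorphUnitInterval_one
    have h0 : stdSimplexHomeomorphUnitInterval (stdSimplex.vertex (Fin.succAbove 1 (0 : Fin 1)))
        = 0 := stdSimplexHomeomorphUnitInterval_zero
    rw [h1, h0]
    simp
  have := (Sing X).ιChainComplex_d (ModuleCat.of ℝ ℝ) (pathSimplex γ)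
  rw [this, Fin.sum_univ_two, h]
  simp

/-- The homology class in `H₁(X; ℝ)` of a loop: the class of the singular cycle `1 • γ`. -/
def loopClass {x : X} (γ : Path x x) : H1 X :=
  ((SC X).liftCycles ((Sing X).ιChainComplex (R := ModuleCat.of ℝ ℝ) (pathSimplex γ)) 0 (by simp)
    (path_chain_d γ) ≫ (SC X).homologyπ 1).hom (1 : ℝ)

/-- A continuous map from a simplex to the circle `ℝ/ℤ` lifts to `ℝ`. -/
theorem exists_lift {n : ℕ} (g : C(stdSimplex ℝ (Fin (n + 1)), AddCircle (1 : ℝ))) :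
    ∃ L : C(stdSimplex ℝ (Fin (n + 1)), ℝ), ∀ v, ((L v : ℝ) : AddCircle (1 : ℝ)) = g v := by
  have : ContractibleSpace (stdSimplex ℝ (Fin (n + 1))) :=
    (convex_stdSimplex ℝ _).contractibleSpace (isPathConnected_stdSimplex _).nonempty
  have : LocallyPathConnectedSpace (stdSimplex ℝ (Fin (n + 1))) :=
    (convex_stdSimplex ℝ _).locallyPathConnectedSpace
  obtain ⟨e, he⟩ := QuotientAddGroup.mk_surjective (g (stdSimplex.vertex 0))
  obtain ⟨L, ⟨-, hL⟩, -⟩ := (AddCircle.isCoveringMap_coe (1 : ℝ)).existsUnique_continuousMap_lifts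
    g (stdSimplex.vertex 0) e he
  exact ⟨L, fun v => congrFun hL v⟩

/-- Two lifts of the same map on a connected space have the same increments. -/
theorem lift_increment_eq {A : Type} [TopologicalSpace A] [PreconnectedSpace A] {L L' : A → ℝ}
    (hL : Continuous L) (hL' : Continuous L')
    (h : ∀ v, ((L v : ℝ) : AddCircle (1 : ℝ)) = (L' v : ℝ)) (a b : A) :
    L b - L a = L' b - L' a := by
  have hint : ∀ v, ∃ k : ℤ, L v - L' v = k := by
    intro v
    have := (h v)
    rw [← sub_eq_zero, ← AddCircle.coe_sub, AddCircle.coe_eq_zero_iff] at this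
    obtain ⟨k, hk⟩ := this
    exact ⟨k, by simpa using hk.symm⟩
  choose k hk using hint
  have hc : Continuous k := by
    have : Continuous fun v => ((k v : ℤ) : ℝ) := by
      simp only [← hk]
      exact hL.sub hL'
    exact (Int.isClosedEmbedding_coe_real.isEmbedding.continuous_iff).2 this
  have hkk : k a = k b := PreconnectedSpace.constant inferInstance hc
  have ha := hk a
  have hb := hk b
  rw [hkk] at ha
  linarith

/-- The total increment, along a singular `1`-simplex `σ` of `X`, of a continuous real lift of
`f ∘ σ`, where `f : X → ℝ/ℤ`. -/
def increment (f : C(X, AddCircle (1 : ℝ))) (σ : (Sing X) _⦋1⦌) : ℝ :=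
  (exists_lift (f.comp (simplexMap σ))).choose (stdSimplex.vertex 1) -
    (exists_lift (f.comp (simplexMap σ))).choose (stdSimplex.vertex 0)

theorem increment_eq (f : C(X, AddCircle (1 : ℝ))) (σ : (Sing X) _⦋1⦌)
    {L : stdSimplex ℝ (Fin 2) → ℝ} (hL : Continuous L)
    (h : ∀ v, ((L v : ℝ) : AddCircle (1 : ℝ)) = f (simplexMap σ v)) :
    increment f σ = L (stdSimplex.vertex 1) - L (stdSimplex.vertex 0) :=
  lift_increment_eq (ContinuousMap.continuous _) hL
    (fun v => ((exists_lift (f.comp (simplexMap σ))).choose_spec v).trans (h v).symm) _ _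

theorem increment_cocycle (f : C(X, AddCircle (1 : ℝ))) (τ : (Sing X) _⦋2⦌) :
    increment f ((Sing X).δ 0 τ) - increment f ((Sing X).δ 1 τ) +
      increment f ((Sing X).δ 2 τ) = 0 := by
  obtain ⟨L, hL⟩ := exists_lift (f.comp (simplexMap τ))
  have key : ∀ i : Fin 3, increment f ((Sing X).δ i τ) =
      L (stdSimplex.vertex (i.succAbove 1)) - L (stdSimplex.vertex (i.succAbove 0)) := by
    intro i
    rw [increment_eq f _ (L := fun v => L (stdSimplex.map i.succAbove v))
      (L.continuous.comp (stdSimplex.continuous_map _)) (fun v => hL _)]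
    simp only [stdSimplex.map_vertex]
  rw [key, key, key]
  have e1 : (0 : Fin 3).succAbove (1 : Fin 2) = 2 := rfl
  have e2 : (0 : Fin 3).succAbove (0 : Fin 2) = 1 := rfl
  have e3 : (1 : Fin 3).succAbove (1 : Fin 2) = 2 := rfl
  have e4 : (1 : Fin 3).succAbove (0 : Fin 2) = 0 := rfl
  have e5 : (2 : Fin 3).succAbove (1 : Fin 2) = 1 := rfl
  have e6 : (2 : Fin 3).succAbove (0 : Fin 2) = 0 := rfl
  rw [e1, e2, e3, e4, e5, e6]
  ring

/-- The increment cocycle, as a linear functional on singular `1`-chains. -/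
def incrementChain (f : C(X, AddCircle (1 : ℝ))) : (SC X).X 1 ⟶ ModuleCat.of ℝ ℝ :=
  Limits.Cofan.IsColimit.desc ((Sing X).isColimitChainComplexXCofan (ModuleCat.of ℝ ℝ) 1)
    fun σ => ModuleCat.ofHom (increment f σ • LinearMap.id)

theorem ι_incrementChain (f : C(X, AddCircle (1 : ℝ))) (σ : (Sing X) _⦋1⦌) :
    (Sing X).ιChainComplex σ ≫ incrementChain f =
      ModuleCat.ofHom (increment f σ • LinearMap.id) :=
  Limits.Cofan.IsColimit.fac ((Sing X).isColimitChainComplexXCofan (ModuleCat.of ℝ ℝ) 1) _ σ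

theorem d_incrementChain (f : C(X, AddCircle (1 : ℝ))) :
    (SC X).d 2 1 ≫ incrementChain f = 0 := by
  apply SSet.chainComplex_hom_ext
  intro τ
  have h := increment_cocycle f τ
  rw [← Category.assoc, SSet.ιChainComplex_d, Preadditive.sum_comp, Limits.comp_zero,
    Fin.sum_univ_three, Preadditive.zsmul_comp, Preadditive.zsmul_comp, Preadditive.zsmul_comp,
    ι_incrementChain, ι_incrementChain, ι_incrementChain]
  ext
  simp
  linarith

/-- For a continuous `f : X → ℝ/ℤ`, the induced homomorphism `f_* : H₁(X; ℝ) → H₁(ℝ/ℤ; ℝ) = ℝ`,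
which maps the class of a loop `γ` to the degree (winding number) of `f ∘ γ`. -/
def winding (f : C(X, AddCircle (1 : ℝ))) : H1 X →ₗ[ℝ] ℝ :=
  ((SC X).homologyι 1 ≫ (SC X).descOpcycles (incrementChain f) 2 (by simp)
    (d_incrementChain f)).hom

theorem winding_loopClass (f : C(X, AddCircle (1 : ℝ))) {x : X} (γ : Path x x)
    {L : unitInterval → ℝ} (hL : Continuous L)
    (h : ∀ r, ((L r : ℝ) : AddCircle (1 : ℝ)) = f (γ r)) :
    winding f (loopClass γ) = L 1 - L 0 := by
  have h1 : winding f (loopClass γ) = ((SC X).liftCycles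
      ((Sing X).ιChainComplex (R := ModuleCat.of ℝ ℝ) (pathSimplex γ)) 0 (by simp)
      (path_chain_d γ) ≫ (SC X).homologyπ 1 ≫ (SC X).homologyι 1 ≫
      (SC X).descOpcycles (incrementChain f) 2 (by simp) (d_incrementChain f)).hom (1 : ℝ) := rfl
  rw [h1, HomologicalComplex.homology_π_ι_assoc, HomologicalComplex.liftCycles_i_assoc,
    HomologicalComplex.p_descOpcycles, ι_incrementChain,
    increment_eq f _ (L := fun v => L (stdSimplexHomeomorphUnitInterval v))
      (hL.comp stdSimplexHomeomorphUnitInterval.continuous)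
      (fun v => by rw [simplexMap_pathSimplex, h])]
  have e1 : stdSimplexHomeomorphUnitInterval (stdSimplex.vertex (1 : Fin 2)) = 1 :=
    stdSimplexHomeomorphUnitInterval_one
  have e0 : stdSimplexHomeomorphUnitInterval (stdSimplex.vertex (0 : Fin 2)) = 0 :=
    stdSimplexHomeomorphUnitInterval_zero
  rw [e1, e0]
  simp

end Homology
/-! ### The array of flat lenses and its vertical light rays -/

/-- The closed horizontal slit of length `2R` centred at `c`. -/
def slit (R : ℝ) (c : ℂ) : Set ℂ := {z | |(z - c).re| ≤ R ∧ (z - c).im = 0}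

/-- The interior of the slit of length `2R` centred at `c` (the slit without its two ends). -/
def openSlit (R : ℝ) (c : ℂ) : Set ℂ := {z | |(z - c).re| < R ∧ (z - c).im = 0}

/-- A vertical light ray in `F(Λ, R)`, followed for all times: `q t` is its position and
`ε t = ±1` its vertical direction at time `t`. Away from the interiors of the slits it moves
vertically with unit speed. When it hits an interior point of the slit centred at `c`, it is rotated
by `π` about `c`, i.e. it jumps to `2c - q`, and then moves in the opposite direction; at such a
time, `q` and `ε` are the values just after the reflection. -/
def IsLightRay (Λ : Submodule ℤ ℂ) (R : ℝ) (q : ℝ → ℂ) (ε : ℝ → ℝ) : Prop :=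
  (∀ t, ε t = 1 ∨ ε t = -1) ∧
  ∀ t, ∃ δ > 0,
    (∀ s ∈ Set.Ico 0 δ, q (t + s) = q t + (ε t * s : ℝ) * Complex.I ∧ ε (t + s) = ε t) ∧
    (((∀ c ∈ Λ, q t ∉ openSlit R c) ∧
        ∀ s ∈ Set.Ioo (-δ) 0, q (t + s) = q t + (ε t * s : ℝ) * Complex.I ∧ ε (t + s) = ε t) ∨
      ∃ c ∈ Λ, q t ∈ openSlit R c ∧
        ∀ s ∈ Set.Ioo (-δ) 0,
          q (t + s) = (2 * c - q t) + (-ε t * s : ℝ) * Complex.I ∧ ε (t + s) = -ε t)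

/-- The closed band of width `w` in direction `v` around the line `p + ℝ v`. -/
def band (p v : ℂ) (w : ℝ) : Set ℂ :=
  {z | Metric.infDist z (Set.range fun r : ℝ => p + (r : ℂ) * v) ≤ w / 2}

/-! ### The translation surfaces `M̃(Λ, R)` and `M(Λ, R)` -/

/-- The half-open parallelogram `P(γ₊, γ₋) = [-1/2, 1/2) γ₊ + [-1/2, 1/2) γ₋`. -/
def parallelogram (gp gm : ℂ) : Set ℂ :=
  {z | ∃ y₁ ∈ Set.Ico (-1 / 2 : ℝ) (1 / 2), ∃ y₂ ∈ Set.Ico (-1 / 2 : ℝ) (1 / 2),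
    z = (y₁ : ℂ) * gp + (y₂ : ℂ) * gm}

/-- A positive basis `γ₊ = gp`, `γ₋ = gm` of the lattice `Λ` such that the slit centred at `0` is
contained in the interior of the parallelogram `P(γ₊, γ₋)`. -/
structure PositiveBasis (Λ : Submodule ℤ ℂ) (R : ℝ) where
  gp : ℂ
  gm : ℂ
  R_pos : 0 < R
  span_eq : Submodule.span ℤ {gp, gm} = Λ
  gp_re : 0 < gp.re
  gp_im : 0 ≤ gp.im
  gm_re : gm.re ≤ 0
  gm_im : 0 < gm.im
  slit_subset : slit R 0 ⊆ interior (parallelogram gp gm)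

namespace PositiveBasis

variable {Λ : Submodule ℤ ℂ} {R : ℝ} (F : PositiveBasis Λ R)

/-- The point of the plane with coordinates `y` in the basis `γ₊, γ₋`. -/
def pos (y : ℝ × ℝ) : ℂ := (y.1 : ℂ) * F.gp + (y.2 : ℂ) * F.gm

/-- The pieces from which `M̃(Λ, R)` is glued. A point is `(m, s, h, y)`: `m ∈ ℤ²` labels the
slit centred at `c = m₁ γ₊ + m₂ γ₋`, `s` is the copy of the plane (`true` for `F₊`, `false` for
`F₋`), and `c + y₁ γ₊ + y₂ γ₋` is the position in that copy (its image under `ζ`), where `y` runs over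
the closed square; the parallelogram is cut along the horizontal line through its centre into a closed
upper half (`h = true`) and a closed lower half (`h = false`). Both copies are drawn in the
coordinates of `F(Λ, R)`; rotating the second one by `π` gives the coordinates of `r_π F₋`. -/
def Piece : Type :=
  {x : (ℤ × ℤ) × Bool × Bool × (ℝ × ℝ) //
    |x.2.2.2.1| ≤ 1 / 2 ∧ |x.2.2.2.2| ≤ 1 / 2 ∧
      (x.2.2.1 = true → 0 ≤ (F.pos x.2.2.2).im) ∧ (x.2.2.1 = false → (F.pos x.2.2.2).im ≤ 0)}

instance : TopologicalSpace F.Piece := inferInstanceAs (TopologicalSpace (Subtype _))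

namespace Piece

variable {F}

/-- The label of the fundamental parallelogram. -/
def label (x : F.Piece) : ℤ × ℤ := x.1.1
/-- The copy of the plane: `true` for `F₊`, `false` for `F₋`. -/
def sheet (x : F.Piece) : Bool := x.1.2.1
/-- The half of the parallelogram: `true` for the upper, `false` for the lower half. -/
def half (x : F.Piece) : Bool := x.1.2.2.1
/-- The coordinates in the fundamental parallelogram. -/
def coord (x : F.Piece) : ℝ × ℝ := x.1.2.2.2

end Piece

/-- The gluing that defines `M̃(Λ, R)`.
* `plane`: in each copy, the pieces are glued back to the plane cut along the slits, i.e. points with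
  the same position are identified unless they lie in the interior of a slit.
* `cross`: crossing the slit with centre `c` leads from the position `c + u` in one copy to
  `c - u` in the other copy, on the same (upper or lower) side. After the rotation `r_π` this glues the
  top of the slit in `F₊` to the bottom of the slit in `r_π F₋`, and conversely. -/
inductive Glue : F.Piece → F.Piece → Prop
  | plane (a b : F.Piece) (hs : a.sheet = b.sheet)
      (h₁ : (a.label.1 : ℝ) + a.coord.1 = b.label.1 + b.coord.1)
      (h₂ : (a.label.2 : ℝ) + a.coord.2 = b.label.2 + b.coord.2)
      (hn : F.pos a.coord ∉ openSlit R 0) : Glue a b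
  | cross (a b : F.Piece) (hs : a.sheet ≠ b.sheet) (hm : a.label = b.label)
      (hh : a.half = b.half) (hc : b.coord = -a.coord) (hp : F.pos a.coord ∈ slit R 0) : Glue a b

/-- The surface `M̃(Λ, R)`. -/
def Cover : Type := Quot F.Glue

instance : TopologicalSpace F.Cover := inferInstanceAs (TopologicalSpace (Quot F.Glue))

/-- The action of `k ∈ ℤ²` on the pieces. -/
def Piece.shift {F : PositiveBasis Λ R} (k : ℤ × ℤ) (x : F.Piece) : F.Piece :=
  ⟨(k + x.1.1, x.1.2), x.2⟩

/-- The action of `k ∈ ℤ²` on `M̃(Λ, R)`, which translates the positions in both copies of the plane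
by the lattice vector `k₁ γ₊ + k₂ γ₋`. -/
def act (k : ℤ × ℤ) : F.Cover → F.Cover :=
  Quot.map (Piece.shift k) (by
    rintro a b (⟨hs, h₁, h₂, hn⟩ | ⟨hs, hm, hh, hc, hp⟩)
    · refine Glue.plane _ _ hs ?_ ?_ hn
      · have e : ∀ x : F.Piece, (((x.shift k).label.1 : ℤ) : ℝ) = k.1 + x.label.1 := fun x => by
          simp [Piece.shift, Piece.label]
        rw [e, e, add_assoc, add_assoc]
        exact congrArg _ h₁
      · have e : ∀ x : F.Piece, (((x.shift k).label.2 : ℤ) : ℝ) = k.2 + x.label.2 := fun x => by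
          simp [Piece.shift, Piece.label]
        rw [e, e, add_assoc, add_assoc]
        exact congrArg _ h₂
    · exact Glue.cross _ _ hs (congrArg (k + ·) hm) hh hc hp)

/-- The compact surface `M(Λ, R)`, the quotient of `M̃(Λ, R)` by the action of `ℤ² ≅ Λ`. -/
def Surface : Type := Quot fun x x' : F.Cover => ∃ k : ℤ × ℤ, x' = F.act k x

instance : TopologicalSpace F.Surface := inferInstanceAs (TopologicalSpace (Quot _))

/-- The covering map `p : M̃(Λ, R) → M(Λ, R)`. -/
def proj : F.Cover → F.Surface := Quot.mk _

theorem continuous_proj : Continuous F.proj := continuous_quot_mk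

/-- The quotient map from the pieces to `M̃(Λ, R)`. -/
def toCover : F.Piece → F.Cover := Quot.mk _

theorem continuous_toCover : Continuous F.toCover := continuous_quot_mk

theorem proj_act (k : ℤ × ℤ) (x : F.Cover) : F.proj (F.act k x) = F.proj x :=
  (Quot.sound ⟨k, rfl⟩).symm

/-- The fundamental domain `D = ζ⁻¹ P(γ₊, γ₋)` of the `ℤ²`-action. -/
def domain : Set F.Cover :=
  F.toCover '' {x | x.label = 0 ∧ x.coord.1 ∈ Set.Ico (-1 / 2 : ℝ) (1 / 2) ∧
    x.coord.2 ∈ Set.Ico (-1 / 2 : ℝ) (1 / 2)}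

/-- The singular points of `M(Λ, R)`, i.e. the zeros of `ω`: the ends of the slit. -/
def singular : Set F.Surface :=
  (fun x => F.proj (F.toCover x)) '' {x | F.pos x.coord = (R : ℂ) ∨ F.pos x.coord = (-R : ℂ)}

/-- `+1` on `F₊` and `-1` on `F₋`. -/
def sgn (s : Bool) : ℂ := if s then 1 else -1

theorem pos_add_int (y y' : ℝ × ℝ) (k l : ℤ) (h₁ : y'.1 = y.1 + k) (h₂ : y'.2 = y.2 + l) :
    F.pos y' - F.pos y ∈ Λ := by
  have hp : F.gp ∈ Λ := F.span_eq.le (Submodule.subset_span (by simp))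
  have hm : F.gm ∈ Λ := F.span_eq.le (Submodule.subset_span (by simp))
  have : F.pos y' - F.pos y = k • F.gp + l • F.gm := by
    simp [pos, h₁, h₂]; ring
  rw [this]
  exact Λ.add_mem (Λ.smul_mem _ hp) (Λ.smul_mem _ hm)

/-- The local coordinate of the translation structure, modulo `Λ`. The position `z` in `F₊`, resp.
`-z` (the position rotated by `π`) in `F₋`, descends to `hol : M(Λ, R) → ℂ/Λ`, which is a local
homeomorphism outside of the singular points; `ω` is the pull-back of `dz`. -/
def hol : F.Surface → ℂ ⧸ Λ :=
  Quot.lift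
    (Quot.lift (fun x : F.Piece => Λ.mkQ (sgn x.sheet * F.pos x.coord)) (by
      rintro a b (⟨hs, h₁, h₂, hn⟩ | ⟨hs, hm, hh, hc, hp⟩)
      · have := F.pos_add_int a.coord b.coord (a.label.1 - b.label.1) (a.label.2 - b.label.2)
          (by push_cast; linarith) (by push_cast; linarith)
        simp only [Submodule.mkQ_apply]
        rw [eq_comm, Submodule.Quotient.eq, hs, ← mul_sub]
        cases b.sheet
        · simpa [sgn] using Λ.neg_mem this
        · simpa [sgn] using this
      · have h1 : sgn b.sheet = - sgn a.sheet := by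
          revert hs
          cases a.sheet <;> cases b.sheet <;> simp [sgn]
        have h2 : F.pos (-a.coord) = - F.pos a.coord := by simp [pos]; ring
        simp only [h1, hc, h2, neg_mul_neg]))
    (by
      rintro x _ ⟨k, rfl⟩
      obtain ⟨x, rfl⟩ := Quot.exists_rep x
      rfl)

/-- `c`, restricted to the time interval `I` (which contains `0`), is an orbit segment of the vertical
flow `φᵛ` of `M(Λ, R)` (unit speed in the positive vertical direction) that starts at `c 0`. -/
def IsVerticalOrbit (c : ℝ → F.Surface) (I : Set ℝ) : Prop :=
  ContinuousOn c I ∧ (∀ t ∈ I, c t ∉ F.singular) ∧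
    ∀ t ∈ I, F.hol (c t) = F.hol (c 0) + Λ.mkQ (t * Complex.I)

/-- The set `M⁺_ω` of points whose positive vertical semi-orbit is well defined. -/
def forwardRegular : Set F.Surface :=
  {x | ∃ c : ℝ → F.Surface, c 0 = x ∧ F.IsVerticalOrbit c (Set.Ici 0)}

/-- `M(Λ, R)` has a vertical saddle connection: a vertical orbit segment that connects singular
points. -/
def HasVerticalSaddleConnection : Prop :=
  ∃ (T : ℝ) (c : ℝ → F.Surface), 0 < T ∧ ContinuousOn c (Set.Icc 0 T) ∧
    c 0 ∈ F.singular ∧ c T ∈ F.singular ∧ (∀ t ∈ Set.Ioo 0 T, c t ∉ F.singular) ∧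
    ∀ t ∈ Set.Icc 0 T, F.hol (c t) = F.hol (c 0) + Λ.mkQ (t * Complex.I)

/-- `h` is the homology class `σ_t(x)`: the class of the loop formed by the vertical orbit segment from
`x` to `φᵛ_t x` and a curve `p ∘ δ` from `φᵛ_t x` back to `x`, where `δ` stays in the fundamental
domain `D`. -/
def IsOrbitClass (x : F.Surface) (t : ℝ) (h : H1 F.Surface) : Prop :=
  ∃ c : ℝ → F.Surface, F.IsVerticalOrbit c (Set.Icc 0 t) ∧
  ∃ α : Path x (c t), (∀ r : unitInterval, α r = c (t * r)) ∧
  ∃ (a b : F.Cover) (δ : Path a b) (ha : c t = F.proj a) (hb : x = F.proj b),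
    (∀ r, δ r ∈ F.domain) ∧
    h = loopClass (α.trans ((δ.map F.continuous_proj).cast ha hb))

/-! ### The classes `γ₁`, `γ₂` and the intersection form -/

/-- The point of `M̃(Λ, R)` over position `y` of the fundamental parallelogram in the copy `s`; on
the slit this is the point seen from above. -/
def point (s : Bool) (y : ℝ × ℝ) (h : |y.1| ≤ 1 / 2 ∧ |y.2| ≤ 1 / 2) : F.Cover :=
  if hy : 0 ≤ (F.pos y).im then
    F.toCover ⟨(0, s, true, y), h.1, h.2, fun _ => hy, fun e => by simp at e⟩
  else F.toCover ⟨(0, s, false, y), h.1, h.2, fun e => by simp at e, fun _ => (not_le.1 hy).le⟩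

theorem continuous_pos : Continuous F.pos := by unfold pos; fun_prop

theorem point_of_nonpos (s : Bool) (y : ℝ × ℝ) (h : |y.1| ≤ 1 / 2 ∧ |y.2| ≤ 1 / 2)
    (hn : F.pos y ∉ openSlit R 0) (hy : (F.pos y).im ≤ 0) :
    F.point s y h =
      F.toCover ⟨(0, s, false, y), h.1, h.2, fun e => by simp at e, fun _ => hy⟩ := by
  unfold point
  split_ifs with hy'
  · exact Quot.sound (Glue.plane _ _ rfl rfl rfl hn)
  · rfl

theorem continuous_point (s : Bool) {T : Type} [TopologicalSpace T] {y : T → ℝ × ℝ}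
    (hy : Continuous y) (h : ∀ r, |(y r).1| ≤ 1 / 2 ∧ |(y r).2| ≤ 1 / 2)
    (hn : ∀ r, F.pos (y r) ∉ openSlit R 0) :
    Continuous fun r => F.point s (y r) (h r) := by
  have hc : Continuous fun r => (F.pos (y r)).im :=
    Complex.continuous_im.comp (F.continuous_pos.comp hy)
  have hA : IsClosed {r | 0 ≤ (F.pos (y r)).im} := isClosed_le continuous_const hc
  have hB : IsClosed {r | (F.pos (y r)).im ≤ 0} := isClosed_le hc continuous_const
  rw [← continuousOn_univ]
  have hU : (Set.univ : Set T) = {r | 0 ≤ (F.pos (y r)).im} ∪ {r | (F.pos (y r)).im ≤ 0} := by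
    ext r; simpa using le_total _ _
  rw [hU]
  refine ContinuousOn.union_of_isClosed ?_ ?_ hA hB
  · rw [continuousOn_iff_continuous_domRestrict]
    have : Set.domRestrict {r | 0 ≤ (F.pos (y r)).im} (fun r => F.point s (y r) (h r)) =
        fun r : {r | 0 ≤ (F.pos (y r)).im} => F.toCover ⟨(0, s, true, y r.1), (h r.1).1, (h r.1).2,
          fun _ => r.2, fun e => by simp at e⟩ := by
      funext r
      exact dif_pos r.2
    rw [this]
    exact F.continuous_toCover.comp (Continuous.subtype_mk (by fun_prop) _)
  · rw [continuousOn_iff_continuous_domRestrict]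
    have : Set.domRestrict {r | (F.pos (y r)).im ≤ 0} (fun r => F.point s (y r) (h r)) =
        fun r : {r | (F.pos (y r)).im ≤ 0} => F.toCover ⟨(0, s, false, y r.1), (h r.1).1,
          (h r.1).2, fun e => by simp at e, fun _ => r.2⟩ := by
      funext r
      exact F.point_of_nonpos s _ (h r.1) (hn r.1) r.2
    rw [this]
    exact F.continuous_toCover.comp (Continuous.subtype_mk (by fun_prop) _)

/-- The area `γ₊ ∧ γ₋` of the fundamental parallelogram. -/
def area : ℝ := F.gp.re * F.gm.im - F.gp.im * F.gm.re

theorem area_pos : 0 < F.area := by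
  have h1 := mul_pos F.gp_re F.gm_im
  have h2 := mul_nonneg F.gp_im (neg_nonneg.2 F.gm_re)
  unfold area
  linarith

/-- The slit centred at `0` consists of points whose `i`-th coordinate in the basis `γ₊, γ₋` has absolute
value at most `extent i`. -/
def extent : Fin 2 → ℝ := ![R * F.gm.im / F.area, R * F.gp.im / F.area]

/-- The coordinates as a vector. -/
def vec (y : ℝ × ℝ) : Fin 2 → ℝ := ![y.1, y.2]

theorem coord_mul_area {y : ℝ × ℝ} (h : (F.pos y).im = 0) :
    y.1 * F.area = (F.pos y).re * F.gm.im ∧ y.2 * F.area = -((F.pos y).re * F.gp.im) := by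
  simp only [pos, Complex.add_im, Complex.mul_im, Complex.ofReal_re, Complex.ofReal_im, zero_mul,
    add_zero, Complex.add_re, Complex.mul_re, sub_zero] at h ⊢
  unfold area
  constructor
  · linear_combination F.gm.re * h * (-1)
  · linear_combination F.gp.re * h

theorem abs_coord_le {y : ℝ × ℝ} (h : F.pos y ∈ slit R 0) (i : Fin 2) :
    |vec y i| ≤ F.extent i := by
  obtain ⟨h1, h2⟩ := h
  rw [sub_zero] at h1 h2
  obtain ⟨e1, e2⟩ := F.coord_mul_area h2
  have ha := F.area_pos
  fin_cases i
  · simp only [vec, extent]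
    change |y.1| ≤ R * F.gm.im / F.area
    rw [le_div_iff₀ ha, ← abs_of_pos ha, ← abs_mul, e1, abs_mul, abs_of_pos F.gm_im]
    exact mul_le_mul_of_nonneg_right h1 F.gm_im.le
  · simp only [vec, extent]
    change |y.2| ≤ R * F.gp.im / F.area
    rw [le_div_iff₀ ha, ← abs_of_pos ha, ← abs_mul, e2, abs_neg, abs_mul, abs_of_nonneg F.gp_im]
    exact mul_le_mul_of_nonneg_right h1 F.gp_im

theorem extent_nonneg (i : Fin 2) : 0 ≤ F.extent i := by
  have ha := F.area_pos
  fin_cases i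
  · exact div_nonneg (mul_nonneg F.R_pos.le F.gm_im.le) ha.le
  · exact div_nonneg (mul_nonneg F.R_pos.le F.gp_im) ha.le

theorem extent_lt (i : Fin 2) : F.extent i < 1 / 2 := by
  have ha := F.area_pos
  have key : ∀ x : ℝ, |x| ≤ R → ∃ y : ℝ × ℝ, y.1 < 1 / 2 ∧ y.2 < 1 / 2 ∧ F.pos y = x := by
    intro x hx
    obtain ⟨y₁, h₁, y₂, h₂, h⟩ := interior_subset (F.slit_subset
      (show (x : ℂ) ∈ slit R 0 from ⟨by simpa using hx, by simp⟩))
    exact ⟨(y₁, y₂), h₁.2, h₂.2, h.symm⟩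
  fin_cases i
  · obtain ⟨y, h1, -, h⟩ := key R (abs_of_pos F.R_pos).le
    have := (F.coord_mul_area (y := y) (by rw [h]; simp)).1
    rw [h, Complex.ofReal_re] at this
    change R * F.gm.im / F.area < 1 / 2
    rw [← this, mul_div_assoc, div_self ha.ne', mul_one]
    exact h1
  · obtain ⟨y, -, h2, h⟩ := key (-R) (by rw [abs_neg]; exact (abs_of_pos F.R_pos).le)
    have := (F.coord_mul_area (y := y) (by rw [h]; simp)).2
    rw [h, Complex.ofReal_re, neg_mul, neg_neg] at this
    change R * F.gp.im / F.area < 1 / 2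
    rw [← this, mul_div_assoc, div_self ha.ne', mul_one]
    exact h2

/-- The monotone map of `[-1/2, 1/2]` onto itself that collapses `[-κ, κ]` to `0` and is linear on the
two remaining intervals. -/
def collapse (κ t : ℝ) : ℝ := (max (t - κ) 0 - max (-t - κ) 0) / (1 - 2 * κ)

theorem collapse_zero {κ t : ℝ} (h : |t| ≤ κ) : collapse κ t = 0 := by
  obtain ⟨h1, h2⟩ := abs_le.1 h
  simp [collapse, max_eq_right (show t - κ ≤ 0 by linarith),
    max_eq_right (show -t - κ ≤ 0 by linarith)]

theorem collapse_half {κ : ℝ} (h₀ : 0 ≤ κ) (h₁ : κ < 1 / 2) : collapse κ (1 / 2) = 1 / 2 := by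
  have : 1 - 2 * κ ≠ 0 := by linarith
  rw [collapse, max_eq_left (by linarith), max_eq_right (by linarith)]
  field_simp
  ring

theorem collapse_neg (κ t : ℝ) : collapse κ (-t) = -collapse κ t := by
  simp only [collapse, neg_neg]; ring

theorem collapse_add_int {κ t t' : ℝ} (h₀ : 0 ≤ κ) (h₁ : κ < 1 / 2) (ht : |t| ≤ 1 / 2)
    (ht' : |t'| ≤ 1 / 2) (k : ℤ) (hk : t' = t + k) : collapse κ t' = collapse κ t + k := by
  obtain ⟨a1, a2⟩ := abs_le.1 ht
  obtain ⟨b1, b2⟩ := abs_le.1 ht'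
  have hk1 : (k : ℝ) ≤ 1 := by linarith
  have hk2 : (-1 : ℝ) ≤ k := by linarith
  have hk1' : k ≤ 1 := by exact_mod_cast hk1
  have hk2' : -1 ≤ k := by exact_mod_cast hk2
  have e := collapse_half h₀ h₁
  have e' := collapse_neg κ (1 / 2)
  interval_cases k
  · have : t = 1 / 2 := by push_cast at hk; linarith
    have : t' = -(1 / 2) := by push_cast at hk; linarith
    subst t t'
    rw [e', e]; norm_num
  · have : t' = t := by simpa using hk
    simp [this]
  · have : t = -(1 / 2) := by push_cast at hk; linarith
    have : t' = 1 / 2 := by push_cast at hk; linarith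
    subst t t'
    rw [e', e]; norm_num

/-- The `i`-th component of the pinching map of the copy `s`, on the pieces. -/
def pinchPiece (s : Bool) (i : Fin 2) (x : F.Piece) : AddCircle (1 : ℝ) :=
  (((if x.sheet = s then 1 else 0) * collapse (F.extent i) (vec x.coord i) : ℝ) : AddCircle (1 : ℝ))

theorem continuous_pinchPiece (s : Bool) (i : Fin 2) : Continuous (F.pinchPiece s i) := by
  have h1 : Continuous fun x : F.Piece => x.sheet :=
    continuous_fst.comp (continuous_snd.comp continuous_subtype_val)
  have h2 : Continuous fun x : F.Piece => x.coord :=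
    continuous_snd.comp (continuous_snd.comp (continuous_snd.comp continuous_subtype_val))
  have h3 : Continuous fun x : F.Piece => vec x.coord i := by
    fin_cases i
    · exact continuous_fst.comp h2
    · exact continuous_snd.comp h2
  have h4 : Continuous (collapse (F.extent i)) := by unfold collapse; fun_prop
  have h5 : Continuous fun x : F.Piece => (if x.sheet = s then (1 : ℝ) else 0) :=
    (continuous_of_discreteTopology (f := fun b : Bool => if b = s then (1 : ℝ) else 0)).comp h1
  exact (AddCircle.continuous_mk' 1).comp (h5.mul (h4.comp h3))

theorem pinchPiece_glue (s : Bool) (i : Fin 2) (a b : F.Piece) (h : F.Glue a b) :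
    F.pinchPiece s i a = F.pinchPiece s i b := by
  obtain ⟨hs, h₁, h₂, hn⟩ | ⟨hs, hm, hh, hc, hp⟩ := h
  · have hb : ∀ x : F.Piece, |vec x.coord i| ≤ 1 / 2 := by
      intro x
      fin_cases i
      · exact x.2.1
      · exact x.2.2.1
    obtain ⟨k, hk⟩ : ∃ k : ℤ, vec b.coord i = vec a.coord i + k := by
      fin_cases i
      · refine ⟨a.label.1 - b.label.1, ?_⟩
        change b.coord.1 = a.coord.1 + _
        push_cast; linarith
      · refine ⟨a.label.2 - b.label.2, ?_⟩
        change b.coord.2 = a.coord.2 + _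
        push_cast; linarith
    have := collapse_add_int (F.extent_nonneg i) (F.extent_lt i) (hb a) (hb b) k hk
    unfold pinchPiece
    rw [hs, this]
    split_ifs
    · rw [one_mul, one_mul, AddCircle.coe_add]
      have : ((k : ℝ) : AddCircle (1 : ℝ)) = 0 := (AddCircle.coe_eq_zero_iff _).2 ⟨k, by simp⟩
      rw [this, add_zero]
    · simp
  · have h1 := F.abs_coord_le hp i
    have h2 : |vec b.coord i| ≤ F.extent i := by
      have : vec b.coord i = - vec a.coord i := by
        rw [hc]; fin_cases i <;> rfl
      rwa [this, abs_neg]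
    simp [pinchPiece, collapse_zero h1, collapse_zero h2]

/-- `M(Λ, R)` is the connected sum, along the slit, of the tori `T₊` and `T₋` that are obtained from
the two copies of the plane. The maps `pinch s 0` and `pinch s 1` are the two components of the
pinching map `M(Λ, R) → ℝ²/ℤ²`, of degree one, onto the torus `T_s` (in coordinates with respect to
`γ₊, γ₋`), which collapses the other torus and the slit to a point. -/
def pinch (s : Bool) (i : Fin 2) : C(F.Surface, AddCircle (1 : ℝ)) where
  toFun := Quot.lift (Quot.lift (F.pinchPiece s i) (F.pinchPiece_glue s i)) (by
    rintro x _ ⟨k, rfl⟩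
    obtain ⟨x, rfl⟩ := Quot.exists_rep x
    rfl)
  continuous_toFun := continuous_quot_lift _ (continuous_quot_lift _ (F.continuous_pinchPiece s i))

/-- The algebraic intersection form `⟨·, ·⟩` on `H₁(M(Λ, R); ℝ)`. On a torus `ℝ²/ℤ²` with its standard
orientation the intersection number of two classes is the determinant of their coordinates, and
the form of a connected sum is the orthogonal sum of the forms of the summands.
Here `winding (pinch s 0) a` and `-winding (pinch s 1) a` are the algebraic numbers of crossings of `a`
with the sides `γ₋ˢ` and `γ₊ˢ` of the parallelogram in the copy `s`. -/
def inter : H1 F.Surface →ₗ[ℝ] H1 F.Surface →ₗ[ℝ] ℝ :=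
  ∑ s : Bool,
    ((LinearMap.mul ℝ ℝ).compl₁₂ (winding (F.pinch s 0)) (winding (F.pinch s 1)) -
      (LinearMap.mul ℝ ℝ).compl₁₂ (winding (F.pinch s 1)) (winding (F.pinch s 0)))

theorem inter_apply (a b : H1 F.Surface) :
    F.inter a b = ∑ s : Bool, (winding (F.pinch s 0) a * winding (F.pinch s 1) b -
      winding (F.pinch s 1) a * winding (F.pinch s 0) b) := by
  simp [inter]
  ring

/-- The coordinates of a point on the side `-1/2 γ₋ + [-1/2, 1/2] γ₊` (for `i = 0`), resp.
`-1/2 γ₊ + [-1/2, 1/2] γ₋` (for `i = 1`), of the parallelogram. -/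
def sideCoord (i : Fin 2) (r : unitInterval) : ℝ × ℝ :=
  if i = 0 then ((r : ℝ) - 1 / 2, -(1 / 2)) else (-(1 / 2), (r : ℝ) - 1 / 2)

theorem sideCoord_bound (i : Fin 2) (r : unitInterval) :
    |(sideCoord i r).1| ≤ 1 / 2 ∧ |(sideCoord i r).2| ≤ 1 / 2 := by
  have h : |(r : ℝ) - 1 / 2| ≤ 1 / 2 := abs_le.2 ⟨by linarith [r.2.1], by linarith [r.2.2]⟩
  have h' : |(-(1 / 2) : ℝ)| ≤ 1 / 2 := by norm_num
  unfold sideCoord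
  split_ifs
  exacts [⟨h, h'⟩, ⟨h', h⟩]

theorem sideCoord_notMem (i : Fin 2) (r : unitInterval) :
    F.pos (sideCoord i r) ∉ openSlit R 0 := by
  intro h
  have h' : F.pos (sideCoord i r) ∈ slit R 0 := ⟨h.1.le, h.2⟩
  have h0 := (F.abs_coord_le h' 0).trans_lt (F.extent_lt 0)
  have h1 := (F.abs_coord_le h' 1).trans_lt (F.extent_lt 1)
  unfold sideCoord vec at h0 h1
  split_ifs at h0 h1
  · norm_num [abs_of_pos] at h1
  · norm_num [abs_of_pos] at h0

theorem continuous_sideCoord (i : Fin 2) : Continuous (sideCoord i) := by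
  unfold sideCoord
  split_ifs <;> fun_prop

/-- The oriented curve `γ₊ˢ` (for `i = 0`), resp. `γ₋ˢ` (for `i = 1`), in `M̃(Λ, R)`: the side
parallel to `γ₊`, resp. `γ₋`, of the fundamental parallelogram in the copy `s`. -/
def sideCurve (s : Bool) (i : Fin 2) :
    Path (F.point s (sideCoord i 0) (sideCoord_bound i 0))
      (F.point s (sideCoord i 1) (sideCoord_bound i 1)) where
  toFun r := F.point s (sideCoord i r) (sideCoord_bound i r)
  continuous_toFun := F.continuous_point s (continuous_sideCoord i) _ (F.sideCoord_notMem i)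
  source' := rfl
  target' := rfl

theorem proj_point_eq (s : Bool) (y y' : ℝ × ℝ) (h : |y.1| ≤ 1 / 2 ∧ |y.2| ≤ 1 / 2)
    (h' : |y'.1| ≤ 1 / 2 ∧ |y'.2| ≤ 1 / 2) (k : ℤ × ℤ) (h₁ : y'.1 = y.1 + k.1)
    (h₂ : y'.2 = y.2 + k.2) (hn : F.pos y ∉ openSlit R 0) :
    F.proj (F.point s y h) = F.proj (F.point s y' h') := by
  have key : ∀ (y : ℝ × ℝ) (h : |y.1| ≤ 1 / 2 ∧ |y.2| ≤ 1 / 2),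
      ∃ x : F.Piece, F.point s y h = F.toCover x ∧ x.label = 0 ∧ x.sheet = s ∧ x.coord = y := by
    intro y h
    unfold point
    split_ifs
    · exact ⟨_, rfl, rfl, rfl, rfl⟩
    · exact ⟨_, rfl, rfl, rfl, rfl⟩
  obtain ⟨x, hx, hl, hs, hc⟩ := key y h
  obtain ⟨x', hx', hl', hs', hc'⟩ := key y' h'
  rw [hx, hx', ← F.proj_act k]
  congr 1
  have e : (x.shift k).label = k := by
    change k + x.label = k
    rw [hl, add_zero]
  have e' : (x.shift k).coord = y := hc
  refine Quot.sound (Glue.plane (x.shift k) x' (hs.trans hs'.symm) ?_ ?_ (e' ▸ hn))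
  · rw [e, e', hl', hc', h₁]; simp; ring
  · rw [e, e', hl', hc', h₂]; simp; ring

theorem proj_side_end (s : Bool) (i : Fin 2) :
    F.proj (F.point s (sideCoord i 0) (sideCoord_bound i 0)) =
      F.proj (F.point s (sideCoord i 1) (sideCoord_bound i 1)) := by
  fin_cases i
  · exact F.proj_point_eq s _ _ _ _ (1, 0) (by norm_num [sideCoord]) (by norm_num [sideCoord])
      (F.sideCoord_notMem 0 0)
  · exact F.proj_point_eq s _ _ _ _ (0, 1) (by norm_num [sideCoord]) (by norm_num [sideCoord])
      (F.sideCoord_notMem 1 0)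

/-- The loop `p(γ₊ˢ)` (for `i = 0`), resp. `p(γ₋ˢ)` (for `i = 1`), in `M(Λ, R)`. -/
def sideLoop (s : Bool) (i : Fin 2) :
    Path (F.proj (F.point s (sideCoord i 0) (sideCoord_bound i 0)))
      (F.proj (F.point s (sideCoord i 0) (sideCoord_bound i 0))) :=
  ((F.sideCurve s i).map F.continuous_proj).cast rfl (F.proj_side_end s i)

/-- In each copy, the curve `γ₊` winds once around the torus in the first coordinate and the curve `γ₋`
once in the second coordinate; neither of them winds around the other torus. -/
theorem winding_sideLoop (s s' : Bool) (i j : Fin 2) :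
    winding (F.pinch s i) (loopClass (F.sideLoop s' j)) = if s' = s ∧ i = j then 1 else 0 := by
  have hs : Continuous fun r => vec (sideCoord j r) i := by
    fin_cases i
    · exact continuous_fst.comp (continuous_sideCoord j)
    · exact continuous_snd.comp (continuous_sideCoord j)
  have hc : Continuous (collapse (F.extent i)) := by unfold collapse; fun_prop
  rw [winding_loopClass (F.pinch s i) (F.sideLoop s' j)
    (L := fun r => (if s' = s then 1 else 0) * collapse (F.extent i) (vec (sideCoord j r) i))
    (continuous_const.mul (hc.comp hs))]
  · have e := collapse_half (F.extent_nonneg i) (F.extent_lt i)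
    have e' : collapse (F.extent i) (-(1 / 2)) = -(1 / 2) := by rw [collapse_neg, e]
    have e'' : (1 : ℝ) - 1 / 2 = 1 / 2 := by norm_num
    by_cases h : s' = s
    · subst h
      fin_cases i <;> fin_cases j <;> simp [sideCoord, vec] at e e' e'' ⊢ <;>
        simp only [e'', e, e'] <;> norm_num
    · simp [h]
  · intro r
    change _ = F.pinch s i (F.proj (F.point s' (sideCoord j r) (sideCoord_bound j r)))
    unfold point
    by_cases hy : 0 ≤ (F.pos (sideCoord j r)).im
    · rw [dif_pos hy]; rfl
    · rw [dif_neg hy]; rfl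

/-- The four loops `p(γ₊⁺), p(γ₋⁺), p(γ₊⁻), p(γ₋⁻)` form a symplectic family for the intersection form. -/
theorem inter_sideLoop (s s' : Bool) :
    F.inter (loopClass (F.sideLoop s 0)) (loopClass (F.sideLoop s' 1)) = (if s = s' then 1 else 0) ∧
    F.inter (loopClass (F.sideLoop s 1)) (loopClass (F.sideLoop s' 0)) =
      (if s = s' then -1 else 0) ∧
    F.inter (loopClass (F.sideLoop s 0)) (loopClass (F.sideLoop s' 0)) = 0 ∧
    F.inter (loopClass (F.sideLoop s 1)) (loopClass (F.sideLoop s' 1)) = 0 := by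
  simp only [inter_apply, winding_sideLoop]
  cases s <;> cases s' <;> simp

/-- The intersection number of a class with `p(γ₋ˢ)`, resp. `p(γ₊ˢ)`, is the algebraic number of times
that it crosses this curve. -/
theorem inter_sideLoop_right (a : H1 F.Surface) (s : Bool) :
    F.inter a (loopClass (F.sideLoop s 1)) = winding (F.pinch s 0) a ∧
    F.inter a (loopClass (F.sideLoop s 0)) = -winding (F.pinch s 1) a := by
  simp only [inter_apply, winding_sideLoop]
  cases s <;> simp

/-- The class `γ₁ = [p(γ₊⁺)] + [p(γ₊⁻)]`. -/
def class₁ : H1 F.Surface := loopClass (F.sideLoop true 0) + loopClass (F.sideLoop false 0)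

/-- The class `γ₂ = [p(γ₋⁺)] + [p(γ₋⁻)]`. -/
def class₂ : H1 F.Surface := loopClass (F.sideLoop true 1) + loopClass (F.sideLoop false 1)

/-- The vector `v̄(Λ, ξ) = ⟨γ₂, ξ⟩ γ₊ - ⟨γ₁, ξ⟩ γ₋`. -/
def bandDirection (ξ : H1 F.Surface) : ℂ :=
  (F.inter F.class₂ ξ : ℂ) * F.gp - (F.inter F.class₁ ξ : ℂ) * F.gm

end PositiveBasis

end

/-! Write `ξ = a γ₁ + b γ₂`. Pairing with `ξ` treats the two copies alike: `⟨σ, ξ⟩ = b w₀ - a w₁`,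
where `wᵢ` is the sum of the winding numbers of `σ` under the `i`-th pinching maps of the two tori
(`inter_combination`). The sum of these two maps lifts to a continuous real function `develop i` on
`M̃`, because the pinching sends both edges of a slit to one point. Pinching moves points by a
bounded amount, so `develop i` stays within `1` of the `i`-th coordinate, in the basis `γ₊, γ₋`, of
the position in the plane. Hence, up to a bounded error, `⟨σ_t, ξ⟩` is the change of `b y₁ - a y₂`
along the light ray, `y` being its coordinates. A bound on this linear form is a bound on the
distance to a line in direction `a γ₊ + b γ₋`, and `v̄ = -2 (a γ₊ + b γ₋)`.

Three points need care. The orbit segment behind `σ_t` is known only through continuity and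
holonomy, so it must be shown to agree with the projected light ray. The map `hol` to `ℂ/Λ` is a
branched double cover whose involution is the rotation by `π`. The function `separator` is odd under
it and vanishes only at singular points, so a connectedness argument gives uniqueness of orbits
(`IsVerticalOrbit.eqOn`).

Light rays must lift continuously to `M̃` (`rayLift`, `continuous_rayLift`): upward motion is placed
in `F₊`, downward motion in `F₋`, and a reflection is then exactly the gluing along the slit.

Finally, a ray may run through an end of a slit, where the hypothesis says nothing. Without saddle
connections this happens at most once, at a time `t₀` (`singular_time_unique`). The bound on the
future of `t₀` follows by a limit, and the bound on its past by exchanging the two copies, which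
reverses the flow and preserves `develop` (`develop_bound_of_ne`). -/

noncomputable section

namespace PositiveBasis

variable {Λ : Submodule ℤ ℂ} {R : ℝ} (F : PositiveBasis Λ R)

/-! ### Coordinates and positions -/

/-- The coordinates of a point of the plane in the basis `γ₊, γ₋`. -/
def coords (z : ℂ) : ℝ × ℝ :=
  ((z.re * F.gm.im - z.im * F.gm.re) / F.area, (z.im * F.gp.re - z.re * F.gp.im) / F.area)

theorem pos_re (y : ℝ × ℝ) : (F.pos y).re = y.1 * F.gp.re + y.2 * F.gm.re := by
  simp [pos]

theorem pos_im (y : ℝ × ℝ) : (F.pos y).im = y.1 * F.gp.im + y.2 * F.gm.im := by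
  simp [pos]

theorem pos_coords (z : ℂ) : F.pos (F.coords z) = z := by
  have ha := F.area_pos.ne'
  apply Complex.ext
  · rw [pos_re]; simp only [coords]; field_simp; unfold area; ring
  · rw [pos_im]; simp only [coords]; field_simp; unfold area; ring

theorem coords_pos (y : ℝ × ℝ) : F.coords (F.pos y) = y := by
  have ha := F.area_pos.ne'
  apply Prod.ext
  · simp only [coords, pos_re, pos_im]; rw [div_eq_iff ha]; unfold area; ring
  · simp only [coords, pos_re, pos_im]; rw [div_eq_iff ha]; unfold area; ring

theorem pos_injective : Function.Injective F.pos := fun a b h => by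
  rw [← F.coords_pos a, h, F.coords_pos]

theorem pos_add (y y' : ℝ × ℝ) : F.pos (y + y') = F.pos y + F.pos y' := by
  simp [pos]; ring

theorem pos_neg (y : ℝ × ℝ) : F.pos (-y) = -F.pos y := by
  simp [pos]; ring

theorem pos_sub (y y' : ℝ × ℝ) : F.pos (y - y') = F.pos y - F.pos y' := by
  simp [pos]; ring

/-- A pair of integers as a pair of real numbers. -/
def intPair (k : ℤ × ℤ) : ℝ × ℝ := (k.1, k.2)

theorem intPair_add (k l : ℤ × ℤ) : intPair (k + l) = intPair k + intPair l := by
  simp [intPair]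

theorem mem_lattice_iff {z : ℂ} : z ∈ Λ ↔ ∃ k : ℤ × ℤ, z = F.pos (intPair k) := by
  have h : z ∈ Λ ↔ z ∈ Submodule.span ℤ {F.gp, F.gm} := by rw [F.span_eq]
  rw [h, Submodule.mem_span_pair]
  constructor
  · rintro ⟨a, b, h⟩
    exact ⟨(a, b), by simp [pos, intPair, ← h]⟩
  · rintro ⟨k, h⟩
    exact ⟨k.1, k.2, by simp [pos, intPair, h]⟩

theorem pos_intPair_mem (k : ℤ × ℤ) : F.pos (intPair k) ∈ Λ := F.mem_lattice_iff.2 ⟨k, rfl⟩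

theorem openSlit_subset_slit (c : ℂ) : openSlit R c ⊆ slit R c := fun _ h => ⟨h.1.le, h.2⟩

theorem mem_openSlit_iff {z c : ℂ} : z ∈ openSlit R c ↔ z - c ∈ openSlit R 0 := by
  simp [openSlit]

theorem mem_slit_iff {z c : ℂ} : z ∈ slit R c ↔ z - c ∈ slit R 0 := by
  simp [slit]

theorem neg_mem_openSlit {z : ℂ} (h : z ∈ openSlit R 0) : -z ∈ openSlit R 0 := by
  simpa [openSlit] using h

theorem abs_coord_lt {y : ℝ × ℝ} (h : F.pos y ∈ slit R 0) : |y.1| < 1 / 2 ∧ |y.2| < 1 / 2 :=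
  ⟨(F.abs_coord_le h 0).trans_lt (F.extent_lt 0), (F.abs_coord_le h 1).trans_lt (F.extent_lt 1)⟩

variable {F}

theorem Piece.ext {a b : F.Piece} (h₁ : a.label = b.label) (h₂ : a.sheet = b.sheet)
    (h₃ : a.half = b.half) (h₄ : a.coord = b.coord) : a = b :=
  Subtype.ext (Prod.ext h₁ (Prod.ext h₂ (Prod.ext h₃ h₄)))

/-- The coordinates of the position of a point in its copy of the plane. -/
def Piece.total (a : F.Piece) : ℝ × ℝ := intPair a.label + a.coord

/-- The position of a point in its copy of the plane. -/
def Piece.position (a : F.Piece) : ℂ := F.pos a.total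

theorem Piece.position_eq (a : F.Piece) :
    a.position = F.pos (intPair a.label) + F.pos a.coord := F.pos_add _ _

theorem int_eq_of_abs_lt {m k : ℤ} {y : ℝ} (h : |y| ≤ 1 / 2) (h' : |(m + y) - k| < 1 / 2) :
    m = k := by
  rw [abs_le] at h
  rw [abs_lt] at h'
  have h1 : (m : ℝ) < k + 1 := by linarith
  have h2 : (k : ℝ) < m + 1 := by linarith
  have h3 : m < k + 1 := by exact_mod_cast h1
  have h4 : k < m + 1 := by exact_mod_cast h2
  omega

/-- The label of a point is ambiguous only on the boundary of a parallelogram, and slits stay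
strictly inside. So near a slit, statements about positions can be turned into statements about
pieces. -/
theorem Piece.label_eq {a : F.Piece} {k : ℤ × ℤ}
    (h : a.position ∈ slit R (F.pos (intPair k))) : a.label = k := by
  rw [mem_slit_iff, position, ← F.pos_sub] at h
  obtain ⟨h1, h2⟩ := F.abs_coord_lt h
  exact Prod.ext (int_eq_of_abs_lt a.2.1 h1) (int_eq_of_abs_lt a.2.2.1 h2)

theorem Piece.position_sub_label (a : F.Piece) :
    a.position - F.pos (intPair a.label) = F.pos a.coord := by
  rw [position_eq]; ring

theorem Piece.mem_openSlit_label {a : F.Piece} :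
    a.position ∈ openSlit R (F.pos (intPair a.label)) ↔ F.pos a.coord ∈ openSlit R 0 := by
  rw [mem_openSlit_iff, position_sub_label]

theorem Piece.coord_notMem {a : F.Piece} (h : ∀ c ∈ Λ, a.position ∉ openSlit R c) :
    F.pos a.coord ∉ openSlit R 0 := fun h' =>
  h _ (F.pos_intPair_mem _) (Piece.mem_openSlit_label.2 h')

/-- Two points of the same copy in the same position agree in `M̃`, unless they lie on opposite sides of
a slit. -/
theorem toCover_eq_of_position {a b : F.Piece} (hs : a.sheet = b.sheet)
    (hp : a.position = b.position) (hh : F.pos a.coord ∈ openSlit R 0 → a.half = b.half) :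
    F.toCover a = F.toCover b := by
  have ht : a.total = b.total := F.pos_injective hp
  by_cases h : F.pos a.coord ∈ openSlit R 0
  · have hl : b.label = a.label := by
      apply Piece.label_eq
      rw [← hp]
      exact openSlit_subset_slit _ (Piece.mem_openSlit_label.2 h)
    congr 1
    refine Piece.ext hl.symm hs (hh h) ?_
    rw [Piece.total, Piece.total, hl] at ht
    exact add_left_cancel ht
  · exact Quot.sound (Glue.plane a b hs (congrArg Prod.fst ht) (congrArg Prod.snd ht) h)

/-- The gluing along the slits, in terms of positions. -/
theorem toCover_eq_of_reflect {a b : F.Piece} (hs : a.sheet ≠ b.sheet) {c : ℂ} (hc : c ∈ Λ)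
    (ha : a.position ∈ openSlit R c) (hb : b.position = 2 * c - a.position)
    (hh : a.half = b.half) : F.toCover a = F.toCover b := by
  obtain ⟨k, rfl⟩ := F.mem_lattice_iff.1 hc
  have hl := Piece.label_eq (openSlit_subset_slit _ ha)
  have hb' : b.position - F.pos (intPair k) = -(a.position - F.pos (intPair k)) := by
    rw [hb]; ring
  have hl' : b.label = k := by
    apply Piece.label_eq
    apply openSlit_subset_slit
    rw [mem_openSlit_iff, hb']
    exact neg_mem_openSlit (mem_openSlit_iff.1 ha)
  refine Quot.sound (Glue.cross a b hs (hl.trans hl'.symm) hh ?_ ?_)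
  · apply F.pos_injective
    rw [F.pos_neg, ← a.position_sub_label, ← b.position_sub_label, hl, hl', hb']
  · rw [← a.position_sub_label, hl]
    exact openSlit_subset_slit _ (mem_openSlit_iff.1 ha)

theorem Piece.position_shift (k : ℤ × ℤ) (a : F.Piece) :
    (a.shift k).position = F.pos (intPair k) + a.position := by
  have : (a.shift k).total = intPair k + a.total := by
    change intPair (k + a.label) + a.coord = intPair k + (intPair a.label + a.coord)
    rw [intPair_add, add_assoc]
  rw [position, this, F.pos_add, position]

theorem proj_toCover_shift (k : ℤ × ℤ) (a : F.Piece) :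
    F.proj (F.toCover (a.shift k)) = F.proj (F.toCover a) :=
  F.proj_act k (F.toCover a)

theorem hol_proj_toCover (a : F.Piece) :
    F.hol (F.proj (F.toCover a)) = Λ.mkQ (sgn a.sheet * a.position) := by
  change Λ.mkQ (sgn a.sheet * F.pos a.coord) = _
  rw [Submodule.mkQ_apply, Submodule.mkQ_apply, eq_comm, Submodule.Quotient.eq, ← mul_sub,
    Piece.position_eq, add_sub_cancel_right]
  cases a.sheet
  · simpa [sgn] using F.pos_intPair_mem _
  · simpa [sgn] using F.pos_intPair_mem _

variable (F)

theorem continuous_coord : Continuous (Piece.coord : F.Piece → ℝ × ℝ) :=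
  continuous_snd.comp (continuous_snd.comp (continuous_snd.comp continuous_subtype_val))

theorem continuous_half : Continuous (Piece.half : F.Piece → Bool) :=
  continuous_fst.comp (continuous_snd.comp (continuous_snd.comp continuous_subtype_val))

theorem continuous_sheet : Continuous (Piece.sheet : F.Piece → Bool) :=
  continuous_fst.comp (continuous_snd.comp continuous_subtype_val)

theorem continuous_label : Continuous (Piece.label : F.Piece → ℤ × ℤ) :=
  continuous_fst.comp continuous_subtype_val

/-! ### The developed pinching map -/

/-- The lift to `ℝ` of the sum of the `i`-th components of the two pinching maps, on the pieces. -/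
def developPiece (i : Fin 2) (a : F.Piece) : ℝ :=
  vec (intPair a.label) i + collapse (F.extent i) (vec a.coord i)

theorem abs_vec_coord_le (a : F.Piece) (i : Fin 2) : |vec a.coord i| ≤ 1 / 2 := by
  fin_cases i
  · exact a.2.1
  · exact a.2.2.1

theorem vec_add (y y' : ℝ × ℝ) (i : Fin 2) : vec (y + y') i = vec y i + vec y' i := by
  fin_cases i <;> rfl

theorem vec_neg (y : ℝ × ℝ) (i : Fin 2) : vec (-y) i = -vec y i := by
  fin_cases i <;> rfl

theorem continuous_vec (i : Fin 2) : Continuous fun y => vec y i := by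
  fin_cases i
  · exact continuous_fst
  · exact continuous_snd

theorem vec_intPair (k : ℤ × ℤ) (i : Fin 2) : ∃ m : ℤ, vec (intPair k) i = m := by
  fin_cases i
  · exact ⟨k.1, rfl⟩
  · exact ⟨k.2, rfl⟩

/-- For planar gluing, `collapse` commutes with the integer translations that relate two labels of
one point. On a slit it vanishes on both sides of the gluing, which leaves the common label. -/
theorem developPiece_glue (i : Fin 2) (a b : F.Piece) (h : F.Glue a b) :
    F.developPiece i a = F.developPiece i b := by
  obtain ⟨hs, h₁, h₂, hn⟩ | ⟨hs, hm, hh, hc, hp⟩ := h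
  · have ht : vec a.total i = vec b.total i := congrArg (vec · i) (Prod.ext h₁ h₂)
    rw [Piece.total, Piece.total, vec_add, vec_add] at ht
    obtain ⟨m, hm⟩ := vec_intPair a.label i
    obtain ⟨n, hn⟩ := vec_intPair b.label i
    have := collapse_add_int (F.extent_nonneg i) (F.extent_lt i) (F.abs_vec_coord_le a i)
      (F.abs_vec_coord_le b i) (m - n) (by push_cast; linarith)
    rw [developPiece, developPiece, this, hm, hn]
    push_cast; ring
  · rw [developPiece, developPiece, hc, vec_neg, collapse_neg,
      collapse_zero (F.abs_coord_le hp i), hm, neg_zero]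

theorem continuous_collapse (κ : ℝ) : Continuous (collapse κ) := by unfold collapse; fun_prop

/-- The developed pinching map: a continuous lift to `M̃` of the sum of the `i`-th components of the
two pinching maps. -/
def develop (i : Fin 2) : C(F.Cover, ℝ) where
  toFun := Quot.lift (F.developPiece i) (F.developPiece_glue i)
  continuous_toFun := continuous_quot_lift _ (by
    have h : Continuous fun a : F.Piece => vec (intPair a.label) i :=
      (continuous_of_discreteTopology (f := fun k : ℤ × ℤ => vec (intPair k) i)).comp
        F.continuous_label
    exact h.add ((continuous_collapse (F.extent i)).comp
      ((continuous_vec i).comp F.continuous_coord)))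

theorem develop_toCover (i : Fin 2) (a : F.Piece) :
    F.develop i (F.toCover a) = F.developPiece i a := rfl

/-- In each copy one of the two pinching maps is zero and the other is the class of `collapse`; the
label is an integer and disappears in the circle. -/
theorem coe_develop (i : Fin 2) (x : F.Cover) :
    ((F.develop i x : ℝ) : AddCircle (1 : ℝ)) =
      F.pinch true i (F.proj x) + F.pinch false i (F.proj x) := by
  obtain ⟨a, rfl⟩ := Quot.exists_rep x
  change ((F.developPiece i a : ℝ) : AddCircle (1 : ℝ)) =
    F.pinchPiece true i a + F.pinchPiece false i a
  obtain ⟨m, hm⟩ := vec_intPair a.label i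
  have h0 : ((m : ℝ) : AddCircle (1 : ℝ)) = 0 := (AddCircle.coe_eq_zero_iff _).2 ⟨m, by simp⟩
  rw [developPiece, hm, AddCircle.coe_add, h0, zero_add]
  unfold pinchPiece
  cases a.sheet <;> simp

theorem abs_collapse_le {κ t : ℝ} (h₁ : κ < 1 / 2) (ht : |t| ≤ 1 / 2) :
    |collapse κ t| ≤ 1 / 2 := by
  obtain ⟨a1, a2⟩ := abs_le.1 ht
  have h : 0 < 1 - 2 * κ := by linarith
  unfold collapse
  rw [abs_div, abs_of_pos h, div_le_iff₀ h, abs_le]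
  have e1 : max (t - κ) 0 ≤ 1 / 2 - κ := max_le (by linarith) (by linarith)
  have e2 : max (-t - κ) 0 ≤ 1 / 2 - κ := max_le (by linarith) (by linarith)
  have e3 := le_max_right (t - κ) 0
  have e4 := le_max_right (-t - κ) 0
  constructor <;> linarith

/-- The labels cancel, and both the collapsed and the true coordinate lie in `[-1/2, 1/2]`. -/
theorem abs_develop_sub_le (i : Fin 2) (a : F.Piece) :
    |F.develop i (F.toCover a) - vec (F.coords a.position) i| ≤ 1 := by
  rw [develop_toCover, developPiece, Piece.position, F.coords_pos, Piece.total, vec_add]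
  have h1 := abs_le.1 (abs_collapse_le (F.extent_lt i)
    (F.abs_vec_coord_le a i))
  have h2 := abs_le.1 (F.abs_vec_coord_le a i)
  rw [abs_le]
  constructor <;> linarith

theorem abs_develop_le_of_mem_domain (i : Fin 2) {x : F.Cover} (hx : x ∈ F.domain) :
    |F.develop i x| ≤ 1 / 2 := by
  obtain ⟨a, ⟨hl, -, -⟩, rfl⟩ := hx
  rw [develop_toCover, developPiece, hl]
  have : vec (intPair 0) i = 0 := by fin_cases i <;> simp [vec, intPair]
  rw [this, zero_add]
  exact abs_collapse_le (F.extent_lt i) (F.abs_vec_coord_le a i)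

end PositiveBasis
end

noncomputable section

namespace PositiveBasis

variable {Λ : Submodule ℤ ℂ} {R : ℝ} (F : PositiveBasis Λ R)

/-! ### Functions that separate the points with the same holonomy -/

/-- A function on the square that vanishes exactly on its boundary. -/
def edge (y : ℝ × ℝ) : ℝ := (1 / 2 - |y.1|) * (1 / 2 - |y.2|)

/-- A function on the square that vanishes exactly on the slit. -/
def slitGap (y : ℝ × ℝ) : ℝ := max (|(F.pos y).re| - R) 0 + |(F.pos y).im|

/-- A function on the square that is positive on the interior of the slit and vanishes on the
boundary of the square and on the rest of the horizontal axis. -/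
def sideWeight (y : ℝ × ℝ) : ℝ := max (R - |(F.pos y).re|) 0 * edge y

/-- A function on the square that vanishes exactly on the slit and is `1` on the boundary. -/
def sheetWeight (y : ℝ × ℝ) : ℝ := F.slitGap y / (F.slitGap y + edge y)

/-- `+1` for `true` and `-1` for `false`. -/
def sign (b : Bool) : ℝ := if b then 1 else -1

theorem sign_not (b : Bool) : sign (!b) = -sign b := by cases b <;> simp [sign]

theorem sign_ne_zero (b : Bool) : sign b ≠ 0 := by cases b <;> simp [sign]

theorem edge_neg (y : ℝ × ℝ) : edge (-y) = edge y := by simp [edge]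

theorem slitGap_neg (y : ℝ × ℝ) : F.slitGap (-y) = F.slitGap y := by
  simp [slitGap, F.pos_neg]

theorem sideWeight_neg (y : ℝ × ℝ) : F.sideWeight (-y) = F.sideWeight y := by
  simp [sideWeight, F.pos_neg, edge_neg]

theorem sheetWeight_neg (y : ℝ × ℝ) : F.sheetWeight (-y) = F.sheetWeight y := by
  simp [sheetWeight, F.slitGap_neg, edge_neg]

theorem slitGap_nonneg (y : ℝ × ℝ) : 0 ≤ F.slitGap y :=
  add_nonneg (le_max_right _ _) (abs_nonneg _)

theorem slitGap_eq_zero_iff {y : ℝ × ℝ} : F.slitGap y = 0 ↔ F.pos y ∈ slit R 0 := by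
  have h1 := le_max_right (|(F.pos y).re| - R) 0
  have h2 := abs_nonneg (F.pos y).im
  simp only [slit, Set.mem_ofPred_eq, sub_zero, slitGap]
  constructor
  · intro h
    refine ⟨?_, abs_eq_zero.1 (by linarith)⟩
    have := le_max_left (|(F.pos y).re| - R) 0
    linarith
  · rintro ⟨h, h'⟩
    rw [h', max_eq_right (by linarith)]; simp

theorem edge_nonneg {y : ℝ × ℝ} (h : |y.1| ≤ 1 / 2 ∧ |y.2| ≤ 1 / 2) : 0 ≤ edge y :=
  mul_nonneg (by linarith [h.1]) (by linarith [h.2])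

theorem edge_pos_of_mem_slit {y : ℝ × ℝ} (h : F.pos y ∈ slit R 0) : 0 < edge y := by
  obtain ⟨h1, h2⟩ := F.abs_coord_lt h
  exact mul_pos (by linarith) (by linarith)

/-- The zero sets of the two summands, the slit and the boundary of the square, are disjoint. This
makes `sheetWeight` continuous. -/
theorem slitGap_add_edge_pos {y : ℝ × ℝ} (h : |y.1| ≤ 1 / 2 ∧ |y.2| ≤ 1 / 2) :
    0 < F.slitGap y + edge y := by
  have h1 := F.slitGap_nonneg y
  have h2 := edge_nonneg h
  rcases h1.eq_or_lt with h0 | h0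
  · have := F.edge_pos_of_mem_slit (F.slitGap_eq_zero_iff.1 h0.symm)
    linarith
  · linarith

theorem sheetWeight_eq_zero_iff {y : ℝ × ℝ} (h : |y.1| ≤ 1 / 2 ∧ |y.2| ≤ 1 / 2) :
    F.sheetWeight y = 0 ↔ F.pos y ∈ slit R 0 := by
  rw [sheetWeight, div_eq_zero_iff, F.slitGap_eq_zero_iff]
  simp [(F.slitGap_add_edge_pos h).ne']

theorem Piece.coord_bound (a : F.Piece) : |a.coord.1| ≤ 1 / 2 ∧ |a.coord.2| ≤ 1 / 2 :=
  ⟨a.2.1, a.2.2.1⟩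

/-- The pair of functions that separates points with the same holonomy, on the pieces. -/
def separatorPiece (a : F.Piece) : ℝ × ℝ :=
  (sign a.half * F.sideWeight a.coord, sign a.sheet * F.sheetWeight a.coord)

theorem abs_eq_half_of_ne {m n : ℤ} {y y' : ℝ} (hy : |y| ≤ 1 / 2) (hy' : |y'| ≤ 1 / 2)
    (h : m + y = n + y') (hmn : m ≠ n) : |y| = 1 / 2 ∧ |y'| = 1 / 2 := by
  by_contra hc
  apply hmn
  rcases hy.eq_or_lt with h1 | h1
  · have h2 : |y'| < 1 / 2 := lt_of_le_of_ne hy' fun h2 => hc ⟨h1, h2⟩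
    exact int_eq_of_abs_lt hy (by rwa [h, add_sub_cancel_left])
  · exact (int_eq_of_abs_lt hy' (by rwa [← h, add_sub_cancel_left])).symm

theorem edge_eq_zero_of_label_ne {a b : F.Piece}
    (h₁ : (a.label.1 : ℝ) + a.coord.1 = b.label.1 + b.coord.1)
    (h₂ : (a.label.2 : ℝ) + a.coord.2 = b.label.2 + b.coord.2) (h : a.label ≠ b.label) :
    edge a.coord = 0 ∧ edge b.coord = 0 := by
  by_cases h1 : a.label.1 = b.label.1
  · have h2 : a.label.2 ≠ b.label.2 := fun h2 => h (Prod.ext h1 h2)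
    obtain ⟨e, e'⟩ := abs_eq_half_of_ne a.2.2.1 b.2.2.1 h₂ h2
    exact ⟨by rw [edge]; change _ * (_ - |a.1.2.2.2.2|) = 0; rw [e]; simp,
      by rw [edge]; change _ * (_ - |b.1.2.2.2.2|) = 0; rw [e']; simp⟩
  · obtain ⟨e, e'⟩ := abs_eq_half_of_ne a.2.1 b.2.1 h₁ h1
    exact ⟨by rw [edge]; change (_ - |a.1.2.2.2.1|) * _ = 0; rw [e]; simp,
      by rw [edge]; change (_ - |b.1.2.2.2.1|) * _ = 0; rw [e']; simp⟩

theorem sheetWeight_eq_one {a : F.Piece} (h : edge a.coord = 0) : F.sheetWeight a.coord = 1 := by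
  have := F.slitGap_add_edge_pos (Piece.coord_bound F a)
  rw [h, add_zero] at this
  rw [sheetWeight, h, add_zero, div_self this.ne']

theorem sideWeight_eq_zero {y : ℝ × ℝ} (h : F.pos y ∉ openSlit R 0) (h' : (F.pos y).im = 0) :
    F.sideWeight y = 0 := by
  have : R ≤ |(F.pos y).re| := by
    by_contra hc
    exact h ⟨by simpa using hc, by simpa using h'⟩
  rw [sideWeight, max_eq_right (by linarith), zero_mul]

theorem im_eq_zero_of_half_ne {a b : F.Piece} (h : a.half ≠ b.half) (hc : a.coord = b.coord) :
    (F.pos a.coord).im = 0 := by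
  have key : ∀ a b : F.Piece, a.half = true → b.half = false → a.coord = b.coord →
      (F.pos a.coord).im = 0 := fun a b ha hb hab =>
    le_antisymm (by rw [hab]; exact b.2.2.2.2 hb) (a.2.2.2.1 ha)
  cases ha : a.half <;> cases hb : b.half
  · exact absurd (ha.trans hb.symm) h
  · rw [hc]; exact key b a hb ha hc.symm
  · exact key a b ha hb hc
  · exact absurd (ha.trans hb.symm) h

/-- Each sign is multiplied by a weight that vanishes where the sign may jump: the half changes on
the axis off the open slit or on the boundary of the square, the copy changes on the slit. On the
boundary, where the label changes, both weights are constant (`0` and `1`). Evenness of the weights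
handles `u ↦ -u`. -/
theorem separatorPiece_glue (a b : F.Piece) (h : F.Glue a b) :
    F.separatorPiece a = F.separatorPiece b := by
  obtain ⟨hs, h₁, h₂, hn⟩ | ⟨hs, hm, hh, hc, hp⟩ := h
  · by_cases hl : a.label = b.label
    · have hc : a.coord = b.coord := by
        rw [hl] at h₁ h₂
        exact Prod.ext (add_left_cancel h₁) (add_left_cancel h₂)
      by_cases hh : a.half = b.half
      · simp [separatorPiece, hs, hc, hh]
      · have h0 := F.sideWeight_eq_zero hn (F.im_eq_zero_of_half_ne hh hc)
        rw [separatorPiece, separatorPiece, ← hc, h0, hs, mul_zero, mul_zero]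
    · obtain ⟨ea, eb⟩ := F.edge_eq_zero_of_label_ne h₁ h₂ hl
      rw [separatorPiece, separatorPiece, F.sheetWeight_eq_one ea, F.sheetWeight_eq_one eb, hs,
        sideWeight, sideWeight, ea, eb]
      simp
  · have h0 := (F.sheetWeight_eq_zero_iff (Piece.coord_bound F a)).2 hp
    rw [separatorPiece, separatorPiece, hc, F.sideWeight_neg, F.sheetWeight_neg, h0, hh]
    simp

/-- A pair of functions on `M` that vanishes exactly at the singular points and separates points with the
same holonomy. -/
def separator : F.Surface → ℝ × ℝ :=
  Quot.lift (Quot.lift F.separatorPiece F.separatorPiece_glue) (by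
    rintro x _ ⟨k, rfl⟩
    obtain ⟨x, rfl⟩ := Quot.exists_rep x
    rfl)

theorem separator_proj (a : F.Piece) : F.separator (F.proj (F.toCover a)) = F.separatorPiece a :=
  rfl

theorem continuous_separator : Continuous F.separator := by
  refine continuous_quot_lift _ (continuous_quot_lift _ ?_)
  have hs : Continuous sign := continuous_of_discreteTopology
  have hp : Continuous fun a : F.Piece => F.pos a.coord := F.continuous_pos.comp F.continuous_coord
  have hre : Continuous fun a : F.Piece => (F.pos a.coord).re := Complex.continuous_re.comp hp
  have him : Continuous fun a : F.Piece => (F.pos a.coord).im := Complex.continuous_im.comp hp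
  have hE : Continuous fun a : F.Piece => edge a.coord := by
    have h1 := continuous_fst.comp F.continuous_coord
    have h2 := continuous_snd.comp F.continuous_coord
    exact (continuous_const.sub h1.abs).mul (continuous_const.sub h2.abs)
  have hA : Continuous fun a : F.Piece => F.slitGap a.coord :=
    ((hre.abs.sub continuous_const).max continuous_const).add him.abs
  exact ((hs.comp F.continuous_half).mul
    (((continuous_const.sub hre.abs).max continuous_const).mul hE)).prodMk
    ((hs.comp F.continuous_sheet).mul (hA.div (hA.add hE)
      fun a => (F.slitGap_add_edge_pos (Piece.coord_bound F a)).ne'))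

/-- The second component vanishes only on the closed slit; there `edge` is positive, so the first
one vanishes only at the two ends. -/
theorem separatorPiece_eq_zero_iff (a : F.Piece) :
    F.separatorPiece a = 0 ↔ F.pos a.coord = (R : ℂ) ∨ F.pos a.coord = (-R : ℂ) := by
  have hR := F.R_pos
  constructor
  · intro h
    have h1 : F.sideWeight a.coord = 0 :=
      (mul_eq_zero.1 (congrArg Prod.fst h)).resolve_left (sign_ne_zero _)
    have h2 : F.sheetWeight a.coord = 0 :=
      (mul_eq_zero.1 (congrArg Prod.snd h)).resolve_left (sign_ne_zero _)
    rw [F.sheetWeight_eq_zero_iff (Piece.coord_bound F a)] at h2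
    have h3 := (mul_eq_zero.1 h1).resolve_right (F.edge_pos_of_mem_slit h2).ne'
    obtain ⟨h4, h5⟩ := h2
    rw [sub_zero] at h4 h5
    have h6 : |(F.pos a.coord).re| = R := by
      have := le_max_left (R - |(F.pos a.coord).re|) 0
      linarith
    rcases (abs_eq hR.le).1 h6 with h7 | h7
    · exact Or.inl (Complex.ext (by simpa using h7) (by simpa using h5))
    · exact Or.inr (Complex.ext (by simpa using h7) (by simpa using h5))
  · intro h
    have h1 : |(F.pos a.coord).re| = R := by
      rcases h with h | h <;> rw [h] <;> simp [abs_of_pos hR]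
    have h2 : (F.pos a.coord).im = 0 := by
      rcases h with h | h <;> rw [h] <;> simp
    have h3 := F.sideWeight_eq_zero (y := a.coord) (fun h' => by
      have := h'.1
      rw [sub_zero, h1] at this
      exact lt_irrefl _ this) h2
    have h4 := (F.sheetWeight_eq_zero_iff (Piece.coord_bound F a)).2
      ⟨by rw [sub_zero, h1], by rw [sub_zero, h2]⟩
    rw [separatorPiece, h3, h4]; simp

theorem separator_eq_zero_iff (x : F.Surface) : F.separator x = 0 ↔ x ∈ F.singular := by
  constructor
  · obtain ⟨x, rfl⟩ := Quot.exists_rep x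
    obtain ⟨a, rfl⟩ := Quot.exists_rep x
    intro h
    exact ⟨a, (F.separatorPiece_eq_zero_iff a).1 h, rfl⟩
  · rintro ⟨a, ha, rfl⟩
    exact (F.separatorPiece_eq_zero_iff a).2 ha

theorem proj_toCover_mem_singular (a : F.Piece) :
    F.proj (F.toCover a) ∈ F.singular ↔
      F.pos a.coord = (R : ℂ) ∨ F.pos a.coord = (-R : ℂ) := by
  rw [← separator_eq_zero_iff, separator_proj, separatorPiece_eq_zero_iff]

/-- The rotation by `π` about the origin, which exchanges the two copies. -/
def Piece.rotate {F : PositiveBasis Λ R} (a : F.Piece) : F.Piece :=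
  ⟨(-a.label, !a.sheet, !a.half, -a.coord), by
    refine ⟨?_, ?_, ?_, ?_⟩
    · exact (abs_neg _).trans_le a.2.1
    · exact (abs_neg _).trans_le a.2.2.1
    · intro h
      rw [F.pos_neg, Complex.neg_im]
      exact neg_nonneg.2 (a.2.2.2.2 (Bool.not_inj (y := false) h))
    · intro h
      rw [F.pos_neg, Complex.neg_im]
      exact neg_nonpos.2 (a.2.2.2.1 (Bool.not_inj (y := true) h))⟩

theorem Piece.position_rotate (a : F.Piece) : a.rotate.position = -a.position := by
  have : a.rotate.total = -a.total := by
    change intPair (-a.label) + -a.coord = -(intPair a.label + a.coord)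
    rw [neg_add]; congr 1; simp [intPair]
  rw [position, this, F.pos_neg, position]

theorem separatorPiece_rotate (a : F.Piece) :
    F.separatorPiece a.rotate = -F.separatorPiece a := by
  change (sign (!a.half) * F.sideWeight (-a.coord), sign (!a.sheet) * F.sheetWeight (-a.coord)) = _
  rw [F.sideWeight_neg, F.sheetWeight_neg, sign_not, sign_not]
  simp [separatorPiece]

theorem exists_shift_position {a b : F.Piece} (h : a.position - b.position ∈ Λ) :
    ∃ k, (b.shift k).position = a.position := by
  obtain ⟨k, hk⟩ := F.mem_lattice_iff.1 h
  exact ⟨k, by rw [Piece.position_shift, ← hk]; ring⟩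

/-- On the slit only the first component survives, and its sign is given by the side of the slit. -/
theorem separatorPiece_eq_neg {a b : F.Piece} (hh : a.half ≠ b.half)
    (ha : F.pos a.coord ∈ openSlit R 0) (hb : b.coord = a.coord ∨ b.coord = -a.coord) :
    F.separatorPiece a = -F.separatorPiece b := by
  have h0 := (F.sheetWeight_eq_zero_iff (Piece.coord_bound F a)).2 (openSlit_subset_slit _ ha)
  have h1 : F.sheetWeight b.coord = F.sheetWeight a.coord := by
    rcases hb with h | h <;> simp [h, F.sheetWeight_neg]
  have h2 : F.sideWeight b.coord = F.sideWeight a.coord := by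
    rcases hb with h | h <;> simp [h, F.sideWeight_neg]
  have h3 : sign a.half = -sign b.half := by
    rw [← sign_not]; congr 1
    revert hh
    cases a.half <;> cases b.half <;> simp
  rw [separatorPiece, separatorPiece, h1, h2, h0, h3]
  simp

/-- A fibre of `hol` consists of a point and its image under the rotation by `π`, which changes the
sign of `separator`. Over the slit these are the two points on its upper and lower side. -/
theorem eq_or_separator_eq_neg {x x' : F.Surface} (h : F.hol x = F.hol x') :
    x = x' ∨ F.separator x = -F.separator x' := by
  obtain ⟨x, rfl⟩ := Quot.exists_rep x
  obtain ⟨a, rfl⟩ := Quot.exists_rep x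
  obtain ⟨x', rfl⟩ := Quot.exists_rep x'
  obtain ⟨b, rfl⟩ := Quot.exists_rep x'
  change F.proj (F.toCover a) = F.proj (F.toCover b) ∨ F.separatorPiece a = -F.separatorPiece b
  have h' : F.hol (F.proj (F.toCover a)) = F.hol (F.proj (F.toCover b)) := h
  rw [hol_proj_toCover, hol_proj_toCover, Submodule.mkQ_apply, Submodule.mkQ_apply,
    Submodule.Quotient.eq] at h'
  by_cases hs : a.sheet = b.sheet
  · obtain ⟨k, hk⟩ : ∃ k, (b.shift k).position = a.position := by
      apply F.exists_shift_position
      rw [hs, ← mul_sub] at h'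
      cases hb : b.sheet <;> rw [hb] at h' <;> simp only [sgn] at h'
      · simpa using Λ.neg_mem h'
      · simpa using h'
    by_cases hh : F.pos a.coord ∈ openSlit R 0 → a.half = (b.shift k).half
    · left
      rw [← proj_toCover_shift k b]
      congr 1
      exact toCover_eq_of_position hs hk.symm hh
    -- Same copy and position, but not glued: the two points lie on opposite sides of one slit.
    · right
      push Not at hh
      have hl : (b.shift k).label = a.label := by
        apply Piece.label_eq
        rw [hk]
        exact openSlit_subset_slit _ (Piece.mem_openSlit_label.2 hh.1)
      refine F.separatorPiece_eq_neg hh.2 hh.1 (Or.inl ?_)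
      apply F.pos_injective
      rw [← a.position_sub_label, ← hk, ← hl]
      exact (b.shift k).position_sub_label.symm
  -- In different copies, `a` is compared with the rotated point, which lies in the same copy.
  · have hs' : a.sheet = b.rotate.sheet := by
      change a.sheet = !b.sheet
      revert hs
      cases a.sheet <;> cases b.sheet <;> simp
    obtain ⟨k, hk⟩ : ∃ k, (b.rotate.shift k).position = a.position := by
      apply F.exists_shift_position
      rw [Piece.position_rotate]
      cases ha : a.sheet <;> cases hb : b.sheet <;> rw [ha, hb] at h' hs <;>
        simp only [sgn] at h'
      · simp at hs
      · have := Λ.neg_mem h'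
        simpa [add_comm] using this
      · simpa using h'
      · simp at hs
    by_cases hh : F.pos a.coord ∈ openSlit R 0 → a.half = (b.rotate.shift k).half
    · right
      have := toCover_eq_of_position (b := b.rotate.shift k) hs' hk.symm hh
      have h2 : F.separatorPiece a = F.separatorPiece (b.rotate.shift k) :=
        congrArg (fun x => F.separator (F.proj x)) this
      rw [h2, ← F.separatorPiece_rotate]
      rfl
    -- Here `a` and the rotated `b` lie on opposite sides of a slit. Rotation exchanges the sides,
    -- so `a` and a translate of `b` are on the same side, at opposite positions, in different
    -- copies: this is the gluing `cross`.
    · left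
      push Not at hh
      have hl : (b.rotate.shift k).label = a.label := by
        apply Piece.label_eq
        rw [hk]
        exact openSlit_subset_slit _ (Piece.mem_openSlit_label.2 hh.1)
      have hc : -b.coord = a.coord := by
        apply F.pos_injective
        rw [← a.position_sub_label, ← hk, ← hl]
        exact (b.rotate.shift k).position_sub_label.symm
      rw [← proj_toCover_shift (a.label - b.label) b]
      congr 1
      refine Quot.sound (Glue.cross _ _ hs ?_ ?_ ?_ (openSlit_subset_slit _ hh.1))
      · exact (sub_add_cancel a.label b.label).symm
      · have h3 : a.half ≠ !b.half := hh.2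
        change a.half = b.half
        revert h3
        cases a.half <;> cases b.half <;> simp
      · rw [← hc, neg_neg]
        rfl

end PositiveBasis
end

/-! ### Uniqueness of vertical orbits and winding numbers of orbit classes -/

noncomputable section

/-- A lift of the sum of two maps to the circle along a loop computes the sum of their winding
numbers. -/
theorem winding_add_winding_loopClass {X : Type} [TopologicalSpace X]
    (f g : C(X, AddCircle (1 : ℝ))) {x : X} (γ : Path x x) {L : unitInterval → ℝ}
    (hL : Continuous L) (h : ∀ r, ((L r : ℝ) : AddCircle (1 : ℝ)) = f (γ r) + g (γ r)) :
    winding f (loopClass γ) + winding g (loopClass γ) = L 1 - L 0 := by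
  have lift : ∀ f : C(X, AddCircle (1 : ℝ)), ∃ M : unitInterval → ℝ, Continuous M ∧
      ∀ r, ((M r : ℝ) : AddCircle (1 : ℝ)) = f (γ r) := by
    intro f
    obtain ⟨M, hM⟩ := exists_lift (n := 1) (f.comp (γ.toContinuousMap.comp
      (stdSimplexHomeomorphUnitInterval : C(stdSimplex ℝ (Fin 2), unitInterval))))
    refine ⟨fun r => M (stdSimplexHomeomorphUnitInterval.symm r), by fun_prop, fun r => ?_⟩
    rw [hM]
    simp
  obtain ⟨M, hM, hM'⟩ := lift f
  obtain ⟨N, hN, hN'⟩ := lift g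
  rw [winding_loopClass f γ hM hM', winding_loopClass g γ hN hN',
    lift_increment_eq hL (hM.add hN) (fun r => by rw [h, Pi.add_apply, AddCircle.coe_add, hM', hN']) 0 1]
  simp only [Pi.add_apply]
  ring

namespace PositiveBasis

variable {Λ : Submodule ℤ ℂ} {R : ℝ} (F : PositiveBasis Λ R)

variable {F} in
/-- Vertical orbit segments are determined by their starting points. -/
theorem IsVerticalOrbit.eqOn {c c' : ℝ → F.Surface} {I : Set ℝ} (hI : IsPreconnected I)
    (h0 : (0 : ℝ) ∈ I) (hc : F.IsVerticalOrbit c I) (hc' : F.IsVerticalOrbit c' I)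
    (h : c 0 = c' 0) : Set.EqOn c c' I := by
  have hhol : ∀ t ∈ I, F.hol (c t) = F.hol (c' t) := fun t ht => by
    rw [hc.2.2 t ht, hc'.2.2 t ht, h]
  have hne : ∀ t ∈ I, F.separator (c' t) ≠ -F.separator (c' t) := fun t ht he =>
    hc'.2.1 t ht ((F.separator_eq_zero_iff _).1 (self_eq_neg.1 he))
  have hs : Continuous fun t : I => F.separator (c t) :=
    F.continuous_separator.comp (continuousOn_iff_continuous_domRestrict.1 hc.1)
  have hs' : Continuous fun t : I => F.separator (c' t) :=
    F.continuous_separator.comp (continuousOn_iff_continuous_domRestrict.1 hc'.1)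
  have : PreconnectedSpace I := Subtype.preconnectedSpace hI
  -- The separators are always equal or opposite, and never both since they do not vanish. So the
  -- complement of this closed set is the closed set where they are opposite.
  have hcl : IsClopen {t : I | F.separator (c t) = F.separator (c' t)} := by
    refine ⟨isClosed_eq hs hs', ?_⟩
    rw [← isClosed_compl_iff]
    convert isClosed_eq hs hs'.neg using 1
    ext t
    simp only [Set.mem_compl_iff, Set.mem_ofPred_eq]
    constructor
    · intro hn
      exact (F.eq_or_separator_eq_neg (hhol t t.2)).resolve_left fun e => hn (by rw [e])
    · intro hn he
      exact hne t t.2 (he.symm.trans hn)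
  have huniv := hcl.eq_univ ⟨⟨0, h0⟩, by change F.separator (c 0) = F.separator (c' 0); rw [h]⟩
  intro t ht
  have he : F.separator (c t) = F.separator (c' t) :=
    (huniv.symm ▸ Set.mem_univ _ : (⟨t, ht⟩ : I) ∈ {t : I | F.separator (c t) = F.separator (c' t)})
  exact (F.eq_or_separator_eq_neg (hhol t ht)).resolve_right fun hn => hne t ht (he.symm.trans hn)

/-- Along a lifted vertical orbit, the developed pinching map follows the sums of the winding numbers of
the classes `σ_t`, up to a bounded error. -/
theorem abs_winding_sub_develop_le {e : ℝ → F.Cover} {t : ℝ} (ht : 0 < t)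
    (he : ContinuousOn e (Set.Icc 0 t))
    (horb : F.IsVerticalOrbit (fun s => F.proj (e s)) (Set.Icc 0 t))
    {σ : H1 F.Surface} (hσ : F.IsOrbitClass (F.proj (e 0)) t σ) (i : Fin 2) :
    |winding (F.pinch true i) σ + winding (F.pinch false i) σ -
      (F.develop i (e t) - F.develop i (e 0))| ≤ 1 := by
  obtain ⟨c, hc, α, hα, a, b, δ, ha, hb, hδ, rfl⟩ := hσ
  have h0 : F.proj (e 0) = c 0 := by
    have := hα 0
    rw [α.source] at this
    simpa using this
  have heq := IsVerticalOrbit.eqOn isPreconnected_Icc ⟨le_rfl, ht.le⟩ horb hc h0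
  have hmem : ∀ r : unitInterval, t * (r : ℝ) ∈ Set.Icc 0 t := fun r =>
    ⟨mul_nonneg ht.le r.2.1, by nlinarith [r.2.2]⟩
  have hcont : Continuous fun r : unitInterval => e (t * r) :=
    he.comp_continuous (by fun_prop) hmem
  have hkey : F.proj (e t) = F.proj a := (heq ⟨ht.le, le_rfl⟩).trans ha
  have hend : ((F.develop i (e t) : ℝ) : AddCircle (1 : ℝ)) = (F.develop i a : ℝ) := by
    rw [coe_develop, coe_develop, hkey]
  -- The lift `e` of the orbit and the curve `δ` meet in `M` but perhaps not in `M̃`. The shift `k`,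
  -- which is zero in the circle, makes the two lifts of the loop fit together.
  obtain ⟨k, hk⟩ : ∃ k : ℝ, k = F.develop i (e t) - F.develop i a := ⟨_, rfl⟩
  have hk0 : (k : AddCircle (1 : ℝ)) = 0 := by
    rw [hk, AddCircle.coe_sub, hend, sub_self]
  let p : Path (F.develop i (e 0)) (F.develop i (e t)) :=
    { toFun := fun r => F.develop i (e (t * r))
      continuous_toFun := (F.develop i).continuous.comp hcont
      source' := by simp
      target' := by simp }
  let q : Path (F.develop i (e t)) (F.develop i b + k) :=
    { toFun := fun r => F.develop i (δ r) + k
      continuous_toFun := ((F.develop i).continuous.comp δ.continuous).add continuous_const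
      source' := by simp [hk]
      target' := by simp }
  rw [winding_add_winding_loopClass (F.pinch true i) (F.pinch false i) _ (p.trans q).continuous]
  · rw [Path.target, Path.source, hk]
    -- The error is the change of `develop` along `δ`, whose two ends lie in the fundamental domain.
    have h1 := abs_le.1 (F.abs_develop_le_of_mem_domain i (δ.source ▸ hδ 0))
    have h2 := abs_le.1 (F.abs_develop_le_of_mem_domain i (δ.target ▸ hδ 1))
    rw [abs_le]
    constructor <;> linarith
  · intro r
    rw [Path.trans_apply, Path.trans_apply]
    split_ifs with hr
    · change ((F.develop i (e (t * _)) : ℝ) : AddCircle (1 : ℝ)) = _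
      rw [coe_develop, hα, ← heq (hmem _)]
    · change ((F.develop i (δ _) + k : ℝ) : AddCircle (1 : ℝ)) = _
      rw [AddCircle.coe_add, hk0, add_zero, coe_develop]
      rfl

theorem inter_combination (σ : H1 F.Surface) (a b : ℝ) :
    F.inter σ (a • F.class₁ + b • F.class₂) =
      b * (winding (F.pinch true 0) σ + winding (F.pinch false 0) σ) -
        a * (winding (F.pinch true 1) σ + winding (F.pinch false 1) σ) := by
  simp only [class₁, class₂, map_add, map_smul, F.inter_sideLoop_right σ, smul_eq_mul]
  ring

/-- Each copy contributes `1` to `⟨γ₁, γ₂⟩`, hence the factor `2`. -/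
theorem bandDirection_combination (a b : ℝ) :
    F.bandDirection (a • F.class₁ + b • F.class₂) = F.pos (-2 * (a, b)) := by
  have h1 : F.inter F.class₁ (a • F.class₁ + b • F.class₂) = 2 * b := by
    rw [inter_combination]
    simp only [class₁, map_add, winding_sideLoop]
    norm_num; ring
  have h2 : F.inter F.class₂ (a • F.class₁ + b • F.class₂) = -2 * a := by
    rw [inter_combination]
    simp only [class₂, map_add, winding_sideLoop]
    norm_num; ring
  rw [bandDirection, h1, h2, pos]
  simp
  ring

/-- If the orbit classes have bounded intersection numbers with `a γ₁ + b γ₂`, then the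
corresponding combination of the developed pinching maps is bounded along lifted orbits. -/
theorem exists_develop_bound {a b C : ℝ}
    (hbound : ∀ x ∈ F.forwardRegular, ∀ t > 0,
      ∃ σ, F.IsOrbitClass x t σ ∧ |F.inter σ (a • F.class₁ + b • F.class₂)| ≤ C)
    {e : ℝ → F.Cover} (he : ContinuousOn e (Set.Ici 0))
    (horb : F.IsVerticalOrbit (fun s => F.proj (e s)) (Set.Ici 0)) {t : ℝ} (ht : 0 < t) :
    |(b * F.develop 0 (e t) - a * F.develop 1 (e t)) -
      (b * F.develop 0 (e 0) - a * F.develop 1 (e 0))| ≤ C + |a| + |b| := by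
  obtain ⟨σ, hσ, hC⟩ := hbound (F.proj (e 0)) ⟨_, rfl, horb⟩ t ht
  have hsub : Set.Icc 0 t ⊆ Set.Ici 0 := Set.Icc_subset_Ici_self
  have horb' : F.IsVerticalOrbit (fun s => F.proj (e s)) (Set.Icc 0 t) :=
    ⟨horb.1.mono hsub, fun s hs => horb.2.1 s (hsub hs), fun s hs => horb.2.2 s (hsub hs)⟩
  have h0 := F.abs_winding_sub_develop_le ht (he.mono hsub) horb' hσ 0
  have h1 := F.abs_winding_sub_develop_le ht (he.mono hsub) horb' hσ 1
  rw [inter_combination] at hC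
  set w0 := winding (F.pinch true 0) σ + winding (F.pinch false 0) σ
  set w1 := winding (F.pinch true 1) σ + winding (F.pinch false 1) σ
  have h0' := mul_le_mul_of_nonneg_left h0 (abs_nonneg b)
  have h1' := mul_le_mul_of_nonneg_left h1 (abs_nonneg a)
  rw [← abs_mul, mul_one, abs_le] at h0' h1'
  rw [abs_le] at hC ⊢
  constructor <;> linarith [h0'.1, h0'.2, h1'.1, h1'.2, hC.1, hC.2]

end PositiveBasis
end

noncomputable section

open Filter Topology

namespace PositiveBasis

variable {Λ : Submodule ℤ ℂ} {R : ℝ} (F : PositiveBasis Λ R)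

/-! ### Lifting light rays to `M̃` -/

/-- The unit interval around `m` has to contain `y` with room left in the direction of motion.
Rounding half-integers up gives room on the right, rounding them down gives room on the left. The
extra `1` in the denominators avoids division by zero. -/
theorem exists_int_abs_sub_le (y v : ℝ) :
    ∃ m : ℤ, ∃ δ > 0, ∀ u ∈ Set.Icc 0 δ, |y + u * v - m| ≤ 1 / 2 := by
  rcases le_or_gt 0 v with hv | hv
  · refine ⟨⌊y + 1 / 2⌋, (1 / 2 - (y - ⌊y + 1 / 2⌋)) / (v + 1), ?_, ?_⟩
    · have := Int.lt_floor_add_one (y + 1 / 2)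
      exact div_pos (by linarith) (by linarith)
    · rintro u ⟨hu0, hu⟩
      rw [le_div_iff₀ (by linarith)] at hu
      have := Int.floor_le (y + 1 / 2)
      have := mul_nonneg hu0 hv
      rw [abs_le]
      constructor <;> linarith
  · refine ⟨⌈y - 1 / 2⌉, ((y - ⌈y - 1 / 2⌉) + 1 / 2) / (1 - v), ?_, ?_⟩
    · have := Int.ceil_lt_add_one (y - 1 / 2)
      exact div_pos (by linarith) (by linarith)
    · rintro u ⟨hu0, hu⟩
      rw [le_div_iff₀ (by linarith)] at hu
      have := Int.le_ceil (y - 1 / 2)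
      have := mul_nonneg hu0 (neg_nonneg.2 hv.le)
      rw [abs_le]
      constructor <;> linarith

theorem coords_add (z w : ℂ) : F.coords (z + w) = F.coords z + F.coords w := by
  apply F.pos_injective
  rw [F.pos_add, F.pos_coords, F.pos_coords, F.pos_coords]

theorem coords_ofReal_mul (r : ℝ) (w : ℂ) : F.coords (r * w) = r • F.coords w := by
  simp only [coords, Complex.re_ofReal_mul, Complex.im_ofReal_mul, Prod.smul_mk, smul_eq_mul]
  congr 1 <;> ring

/-- A short vertical segment starting at `z` in the copy `s` runs in a single piece. -/
theorem exists_germ (s : Bool) (z : ℂ) {σ : ℝ} (hσ : σ = 1 ∨ σ = -1) :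
    ∃ δ > 0, ∃ g : ℝ → F.Piece, Continuous g ∧
      (∀ u ∈ Set.Icc 0 δ, (g u).sheet = s ∧ (g u).position = z + (σ * u : ℝ) * Complex.I) ∧
      (∀ u ∈ Set.Ioc 0 δ, (F.pos (g u).coord).im ≠ 0) ∧
      ((F.pos (g 0).coord).im = 0 → (g 0).half = decide (σ = 1)) := by
  obtain ⟨m, δ₁, hδ₁, hm⟩ := exists_int_abs_sub_le (F.coords z).1 (σ * (F.coords Complex.I).1)
  obtain ⟨n, δ₂, hδ₂, hn⟩ := exists_int_abs_sub_le (F.coords z).2 (σ * (F.coords Complex.I).2)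
  set y : ℝ → ℝ × ℝ := fun u => F.coords (z + (σ * u : ℝ) * Complex.I) - intPair (m, n) with hy
  have hy0 : ∀ u, F.pos (y u) = z + (σ * u : ℝ) * Complex.I - F.pos (intPair (m, n)) := fun u => by
    rw [hy]; simp only; rw [F.pos_sub, F.pos_coords]
  have hyu : ∀ u, y u = ((F.coords z).1 + u * (σ * (F.coords Complex.I).1) - m,
      (F.coords z).2 + u * (σ * (F.coords Complex.I).2) - n) := fun u => by
    rw [hy]; simp only
    rw [F.coords_add, F.coords_ofReal_mul]
    ext
    · simp [intPair]; ring
    · simp [intPair]; ring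
  set w : ℝ := (F.pos (y 0)).im with hw
  have him : ∀ u, (F.pos (y u)).im = w + σ * u := fun u => by
    rw [hw, hy0, hy0]; simp; ring
  -- The half is given by the sign of the height `w`; at height zero it is the half into which the
  -- motion leads.
  obtain ⟨h, δ₃, hδ₃, hh1, hh2, hh3, hh4⟩ : ∃ h : Bool, ∃ δ₃ > 0,
      (h = true → ∀ u ∈ Set.Icc 0 δ₃, 0 ≤ w + σ * u) ∧
      (h = false → ∀ u ∈ Set.Icc 0 δ₃, w + σ * u ≤ 0) ∧
      (∀ u ∈ Set.Ioc 0 δ₃, w + σ * u ≠ 0) ∧ (w = 0 → h = decide (σ = 1)) := by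
    have hσ' : |σ| = 1 := by rcases hσ with h | h <;> simp [h]
    have habs : ∀ u : ℝ, 0 ≤ u → -u ≤ σ * u ∧ σ * u ≤ u := fun u hu => by
      rw [← abs_le, abs_mul, hσ', one_mul, abs_of_nonneg hu]
    rcases lt_trichotomy w 0 with h0 | h0 | h0
    · refine ⟨false, -w / 2, by linarith, by simp, fun _ u hu => ?_, fun u hu => ?_,
        fun e => absurd e h0.ne⟩
      · linarith [(habs u hu.1).2, hu.2]
      · have := (habs u hu.1.le).2
        have := hu.2
        exact ne_of_lt (by linarith)
    · refine ⟨decide (σ = 1), 1, one_pos, fun e u hu => ?_, fun e u hu => ?_, fun u hu => ?_,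
        fun _ => rfl⟩
      · rw [decide_eq_true_iff] at e
        rw [h0, e]; linarith [hu.1]
      · rw [decide_eq_false_iff_not] at e
        rw [h0, hσ.resolve_left e]; linarith [hu.1]
      · rw [h0, zero_add]
        exact mul_ne_zero (by rcases hσ with h | h <;> simp [h]) hu.1.ne'
    · refine ⟨true, w / 2, by linarith, fun _ u hu => ?_, by simp, fun u hu => ?_,
        fun e => absurd e h0.ne'⟩
      · linarith [(habs u hu.1).1, hu.2]
      · have := (habs u hu.1.le).1
        have := hu.2
        exact ne_of_gt (by linarith)
  set δ := min δ₁ (min δ₂ δ₃) with hδ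
  have hδ0 : 0 < δ := lt_min hδ₁ (lt_min hδ₂ hδ₃)
  -- Clamping the time to `[0, δ]` makes the germ a continuous map on all of `ℝ`.
  set cl : ℝ → ℝ := fun u => max 0 (min u δ) with hcl
  have hclm : ∀ u, cl u ∈ Set.Icc 0 δ := fun u =>
    ⟨le_max_left _ _, max_le hδ0.le (min_le_right _ _)⟩
  have hcle : ∀ u ∈ Set.Icc 0 δ, cl u = u := fun u hu => by
    rw [hcl]; simp only; rw [min_eq_left hu.2, max_eq_right hu.1]
  have h1 : ∀ u ∈ Set.Icc 0 δ, u ∈ Set.Icc 0 δ₁ := fun u hu => ⟨hu.1, hu.2.trans (min_le_left _ _)⟩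
  have h2 : ∀ u ∈ Set.Icc 0 δ, u ∈ Set.Icc 0 δ₂ := fun u hu =>
    ⟨hu.1, hu.2.trans ((min_le_right _ _).trans (min_le_left _ _))⟩
  have h3 : ∀ u ∈ Set.Icc 0 δ, u ∈ Set.Icc 0 δ₃ := fun u hu =>
    ⟨hu.1, hu.2.trans ((min_le_right _ _).trans (min_le_right _ _))⟩
  refine ⟨δ, hδ0, fun u => ⟨((m, n), s, h, y (cl u)), ?_, ?_, ?_, ?_⟩, ?_, ?_, ?_, ?_⟩
  · rw [hyu]; exact hm _ (h1 _ (hclm u))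
  · rw [hyu]; exact hn _ (h2 _ (hclm u))
  · intro e; change 0 ≤ (F.pos (y (cl u))).im; rw [him]; exact hh1 e _ (h3 _ (hclm u))
  · intro e; change (F.pos (y (cl u))).im ≤ 0; rw [him]; exact hh2 e _ (h3 _ (hclm u))
  · refine Continuous.subtype_mk ?_ _
    have hyc : Continuous y := by
      rw [show y = _ from funext hyu]; fun_prop
    have hclc : Continuous cl := by fun_prop
    have := hyc.comp hclc
    fun_prop
  · intro u hu
    refine ⟨rfl, ?_⟩
    refine (Piece.position_eq _).trans ?_
    change F.pos (intPair (m, n)) + F.pos (y (cl u)) = _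
    rw [hy0, hcle u hu]; ring
  · intro u hu
    change (F.pos (y (cl u))).im ≠ 0
    rw [him, hcle u ⟨hu.1.le, hu.2⟩]
    exact hh3 u ⟨hu.1, (h3 u ⟨hu.1.le, hu.2⟩).2⟩
  · intro e
    apply hh4
    have e' : (F.pos (y (cl 0))).im = 0 := e
    rwa [hcle 0 ⟨le_rfl, hδ0.le⟩] at e'

/-- On a slit the side is the one the ray is about to enter: above in `F₊`, below in `F₋`. With the
Boolean conventions this reads `half = sheet`. -/
theorem exists_piece (s : Bool) (z : ℂ) : ∃ a : F.Piece, a.sheet = s ∧ a.position = z ∧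
    (F.pos a.coord ∈ openSlit R 0 → a.half = s) := by
  obtain ⟨δ, hδ, g, -, h1, -, h3⟩ :=
    F.exists_germ s z (σ := sign s) (by cases s <;> simp [sign])
  refine ⟨g 0, (h1 0 ⟨le_rfl, hδ.le⟩).1, by rw [(h1 0 ⟨le_rfl, hδ.le⟩).2]; simp, fun h => ?_⟩
  rw [h3 (by simpa using h.2)]
  cases s <;> simp [sign]; norm_num

/-- The point of `M̃` at the position `z` in the copy `s`, on the side to which the vertical flow
leads. -/
def rayPoint (s : Bool) (z : ℂ) : F.Cover := F.toCover (F.exists_piece s z).choose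

variable {F}

theorem rayPoint_eq {s : Bool} {z : ℂ} {a : F.Piece} (hs : a.sheet = s) (hz : a.position = z)
    (hh : F.pos a.coord ∈ openSlit R 0 → a.half = s) : F.rayPoint s z = F.toCover a := by
  obtain ⟨h1, h2, h3⟩ := (F.exists_piece s z).choose_spec
  refine (toCover_eq_of_position (hs.trans h1.symm) (hz.trans h2.symm) fun h => ?_).symm
  refine (hh h).trans (h3 ?_).symm
  have hl := Piece.label_eq (a := (F.exists_piece s z).choose) (k := a.label) (by
    rw [h2, ← hz]; exact openSlit_subset_slit _ (Piece.mem_openSlit_label.2 h))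
  rw [← Piece.mem_openSlit_label, hl, h2, ← hz]
  exact Piece.mem_openSlit_label.2 h

theorem Piece.im_coord_eq_zero {a : F.Piece} {c : ℂ} (hc : c ∈ Λ)
    (h : a.position ∈ openSlit R c) : (F.pos a.coord).im = 0 := by
  obtain ⟨k, rfl⟩ := F.mem_lattice_iff.1 hc
  rw [← a.position_sub_label, Piece.label_eq (openSlit_subset_slit _ h)]
  exact h.2

/-- Continuity of the lift at a reflection: a ray that arrives at `2c - z` in the other copy leaves
from `z` on the same side of the slit, and `cross` identifies these two points. -/
theorem rayPoint_reflect {s : Bool} {z c : ℂ} (hc : c ∈ Λ) (hz : z ∈ openSlit R c) {b : F.Piece}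
    (hs : b.sheet = !s) (hb : b.position = 2 * c - z) (hh : b.half = s) :
    F.rayPoint s z = F.toCover b := by
  obtain ⟨h1, h2, h3⟩ := (F.exists_piece s z).choose_spec
  have h2' : (F.exists_piece s z).choose.position ∈ openSlit R c := by rwa [h2]
  refine toCover_eq_of_reflect (by rw [h1, hs]; cases s <;> simp) hc h2' (by rw [hb, h2]) ?_
  rw [hh]
  apply h3
  obtain ⟨k, rfl⟩ := F.mem_lattice_iff.1 hc
  rw [← Piece.mem_openSlit_label, Piece.label_eq (openSlit_subset_slit _ h2')]
  exact h2'

theorem hol_rayPoint (s : Bool) (z : ℂ) :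
    F.hol (F.proj (F.rayPoint s z)) = Λ.mkQ (sgn s * z) := by
  obtain ⟨h1, h2, h3⟩ := (F.exists_piece s z).choose_spec
  rw [rayPoint, hol_proj_toCover, h1, h2]

theorem notMem_openSlit_of_im {z : ℂ} (h : z.im ≠ 0) : z ∉ openSlit R 0 := fun h' =>
  h (by simpa using h'.2)

theorem notMem_singular_of_im {a : F.Piece} (h : (F.pos a.coord).im ≠ 0) :
    F.proj (F.toCover a) ∉ F.singular := by
  rw [F.proj_toCover_mem_singular]
  rintro (h' | h') <;> rw [h'] at h <;> simp at h

variable (F)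

/-- The copy of the plane for the direction `r = ±1`. -/
def dirSheet (r : ℝ) : Bool := decide (r = 1)

theorem sgn_dirSheet {r : ℝ} (h : r = 1 ∨ r = -1) : sgn (dirSheet r) = r := by
  rcases h with rfl | rfl
  · simp [sgn, dirSheet]
  · simp [sgn, dirSheet]; norm_num

theorem dirSheet_neg {r : ℝ} (h : r = 1 ∨ r = -1) : dirSheet (-r) = !dirSheet r := by
  rcases h with rfl | rfl <;> simp [dirSheet] <;> norm_num

/-- The lift of a light ray to `M̃`. -/
def rayLift (q : ℝ → ℂ) (ε : ℝ → ℝ) (t : ℝ) : F.Cover := F.rayPoint (dirSheet (ε t)) (q t)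

section

variable {F} {q : ℝ → ℂ} {ε : ℝ → ℝ}

/-- A light ray moves in a single piece shortly after each time. -/
theorem rayLift_forward (h : IsLightRay Λ R q ε) (t : ℝ) :
    ∃ δ > 0, ∃ g : ℝ → F.Piece, Continuous g ∧
      (∀ u ∈ Set.Ico 0 δ, F.rayLift q ε (t + u) = F.toCover (g u)) ∧
      ∀ u ∈ Set.Ioo 0 δ, (F.pos (g u).coord).im ≠ 0 := by
  obtain ⟨hε, h⟩ := h
  obtain ⟨δ, hδ, hf, -⟩ := h t
  obtain ⟨δ', hδ', g, hg, h1, h2, h3⟩ := F.exists_germ (dirSheet (ε t)) (q t) (hε t)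
  have key : ∀ u, 0 ≤ u → u < min δ δ' → u ∈ Set.Icc 0 δ' ∧ u ∈ Set.Ico 0 δ := fun u h0 hu =>
    ⟨⟨h0, hu.le.trans (min_le_right _ _)⟩, ⟨h0, hu.trans_le (min_le_left _ _)⟩⟩
  refine ⟨min δ δ', lt_min hδ hδ', g, hg, ?_, ?_⟩
  · rintro u ⟨hu0, hu⟩
    obtain ⟨m1, m2⟩ := key u hu0 hu
    obtain ⟨e1, e2⟩ := hf u m2
    rw [rayLift, e1, e2]
    refine rayPoint_eq (h1 u m1).1 (h1 u m1).2 fun hs => ?_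
    rcases hu0.eq_or_lt with rfl | hu0
    · exact h3 (by simpa using hs.2)
    · exact absurd (by simpa using hs.2) (h2 u ⟨hu0, m1.2⟩)
  · rintro u ⟨hu0, hu⟩
    exact h2 u ⟨hu0, (key u hu0.le hu).1.2⟩

/-- A light ray moves in a single piece shortly before each time. -/
theorem rayLift_backward (h : IsLightRay Λ R q ε) (t : ℝ) :
    ∃ δ > 0, ∃ g : ℝ → F.Piece, Continuous g ∧
      (∀ u ∈ Set.Ico 0 δ, F.rayLift q ε (t - u) = F.toCover (g u)) ∧
      ∀ u ∈ Set.Ioo 0 δ, (F.pos (g u).coord).im ≠ 0 := by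
  obtain ⟨hε, h⟩ := h
  obtain ⟨δ, hδ, -, hb⟩ := h t
  have hε' : -ε t = 1 ∨ -ε t = -1 := by
    rcases hε t with e | e <;> simp [e]
  -- Seen backwards in time, the ray leaves the limit position `z` in direction `σ` within the copy
  -- `s`. What remains in each case is that this limit point is the value of the lift at time `t`.
  have main : ∀ (z : ℂ) (σ : ℝ), (σ = 1 ∨ σ = -1) → ∀ s : Bool,
      (∀ g0 : F.Piece, g0.sheet = s → g0.position = z →
        ((F.pos g0.coord).im = 0 → g0.half = decide (σ = 1)) →
        F.rayLift q ε t = F.toCover g0) →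
      (∀ u ∈ Set.Ioo 0 δ, q (t - u) = z + (σ * u : ℝ) * Complex.I ∧ dirSheet (ε (t - u)) = s) →
      ∃ δ > 0, ∃ g : ℝ → F.Piece, Continuous g ∧
        (∀ u ∈ Set.Ico 0 δ, F.rayLift q ε (t - u) = F.toCover (g u)) ∧
        ∀ u ∈ Set.Ioo 0 δ, (F.pos (g u).coord).im ≠ 0 := by
    intro z σ hσ s h0 hq
    obtain ⟨δ', hδ', g, hg, h1, h2, h3⟩ := F.exists_germ s z hσ
    refine ⟨min δ δ', lt_min hδ hδ', g, hg, ?_, fun u hu =>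
      h2 u ⟨hu.1, hu.2.le.trans (min_le_right _ _)⟩⟩
    rintro u ⟨hu0, hu⟩
    have m1 : u ∈ Set.Icc 0 δ' := ⟨hu0, hu.le.trans (min_le_right _ _)⟩
    rcases hu0.eq_or_lt with rfl | hu0
    · rw [sub_zero]
      exact h0 (g 0) (h1 0 m1).1 (by rw [(h1 0 m1).2]; simp) h3
    · obtain ⟨e1, e2⟩ := hq u ⟨hu0, hu.trans_le (min_le_left _ _)⟩
      rw [rayLift, e1, e2]
      exact rayPoint_eq (h1 u m1).1 (h1 u m1).2 fun hs =>
        absurd hs (notMem_openSlit_of_im (h2 u ⟨hu0, m1.2⟩))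
  have hneg : ∀ u ∈ Set.Ioo 0 δ, -u ∈ Set.Ioo (-δ) 0 := fun u hu =>
    ⟨neg_lt_neg hu.2, neg_lt_zero.2 hu.1⟩
  rcases hb with ⟨hn, hb⟩ | ⟨c, hc, hq, hb⟩
  · refine main (q t) (-ε t) hε' (dirSheet (ε t)) ?_ ?_
    · intro g0 hs hp _
      exact rayPoint_eq hs hp fun h' => absurd h' (Piece.coord_notMem (by rwa [hp]))
    · intro u hu
      obtain ⟨e1, e2⟩ := hb (-u) (hneg u hu)
      rw [← sub_eq_add_neg] at e1 e2
      exact ⟨by rw [e1]; push_cast; ring, by rw [e2]⟩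
  -- Before the reflection the direction was `-ε t`, so the ray traced backwards from `2c - q t`
  -- runs in direction `ε t`.
  · refine main (2 * c - q t) (ε t) (hε t) (!dirSheet (ε t)) ?_ ?_
    · intro g0 hs hp hh
      refine rayPoint_reflect hc hq hs hp (hh (Piece.im_coord_eq_zero hc ?_))
      rw [hp, mem_openSlit_iff]
      have := neg_mem_openSlit (mem_openSlit_iff.1 hq)
      rwa [show 2 * c - q t - c = -(q t - c) by ring]
    · intro u hu
      obtain ⟨e1, e2⟩ := hb (-u) (hneg u hu)
      rw [← sub_eq_add_neg] at e1 e2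
      exact ⟨by rw [e1]; push_cast; ring, by rw [e2, dirSheet_neg (hε t)]⟩

theorem continuous_rayLift (h : IsLightRay Λ R q ε) : Continuous (F.rayLift q ε) := by
  rw [continuous_iff_continuousAt]
  intro t
  rw [continuousAt_iff_continuous_left_right]
  constructor
  · obtain ⟨δ, hδ, g, hg, h1, -⟩ := F.rayLift_backward h t
    have hc : ContinuousWithinAt (fun t' => F.toCover (g (t - t'))) (Set.Iic t) t :=
      (F.continuous_toCover.comp (hg.comp (continuous_const.sub continuous_id))).continuousWithinAt
    refine hc.congr_of_eventuallyEq_of_mem ?_ Set.self_mem_Iic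
    filter_upwards [Ioc_mem_nhdsLE (sub_lt_self t hδ)] with t' ht'
    rw [← h1 (t - t') ⟨by linarith [ht'.2], by linarith [ht'.1]⟩, sub_sub_cancel]
  · obtain ⟨δ, hδ, g, hg, h1, -⟩ := F.rayLift_forward h t
    have hc : ContinuousWithinAt (fun t' => F.toCover (g (t' - t))) (Set.Ici t) t :=
      (F.continuous_toCover.comp (hg.comp (continuous_id.sub continuous_const))).continuousWithinAt
    refine hc.congr_of_eventuallyEq_of_mem ?_ Set.self_mem_Ici
    filter_upwards [Ico_mem_nhdsGE (lt_add_of_pos_right t hδ)] with t' ht'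
    rw [← h1 (t' - t) ⟨by linarith [ht'.1], by linarith [ht'.2]⟩, add_sub_cancel]

/-- A vertical segment leaves the horizontal line through the ends of a slit at once. In particular
singular times are isolated. -/
theorem eventually_notMem_singular (h : IsLightRay Λ R q ε) (t : ℝ) :
    ∀ᶠ t' in 𝓝[≠] t, F.proj (F.rayLift q ε t') ∉ F.singular := by
  rw [← nhdsLT_sup_nhdsGT, eventually_sup]
  constructor
  · obtain ⟨δ, hδ, g, -, h1, h2⟩ := F.rayLift_backward h t
    filter_upwards [Ioo_mem_nhdsLT (sub_lt_self t hδ)] with t' ht'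
    have := h1 (t - t') ⟨by linarith [ht'.2], by linarith [ht'.1]⟩
    rw [sub_sub_cancel] at this
    rw [this]
    exact notMem_singular_of_im (h2 _ ⟨by linarith [ht'.2], by linarith [ht'.1]⟩)
  · obtain ⟨δ, hδ, g, -, h1, h2⟩ := F.rayLift_forward h t
    filter_upwards [Ioo_mem_nhdsGT (lt_add_of_pos_right t hδ)] with t' ht'
    have := h1 (t' - t) ⟨by linarith [ht'.1], by linarith [ht'.2]⟩
    rw [add_sub_cancel] at this
    rw [this]
    exact notMem_singular_of_im (h2 _ ⟨by linarith [ht'.1], by linarith [ht'.2]⟩)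

/-- The product `ε q` moves upwards with unit speed since `ε² = 1`, and a reflection about `c`
changes it by `±2c ∈ Λ`. Modulo `Λ`, subtracting `t i` therefore leaves a locally constant function
of time. -/
theorem hol_rayLift (h : IsLightRay Λ R q ε) (t u : ℝ) :
    F.hol (F.proj (F.rayLift q ε (t + u))) =
      F.hol (F.proj (F.rayLift q ε t)) + Λ.mkQ (u * Complex.I) := by
  have hv : ∀ t, F.hol (F.proj (F.rayLift q ε t)) = Λ.mkQ (ε t * q t) := fun t => by
    rw [rayLift, hol_rayPoint, sgn_dirSheet (h.1 t)]
  have hsq : ∀ t, (ε t : ℂ) * ε t = 1 := fun t => by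
    rcases h.1 t with e | e <;> rw [e] <;> simp
  have hloc : IsLocallyConstant fun t : ℝ =>
      F.hol (F.proj (F.rayLift q ε t)) - Λ.mkQ (t * Complex.I) := by
    rw [IsLocallyConstant.iff_eventually_eq]
    intro t
    have key : ∃ δ > 0, ∀ s ∈ Set.Ioo (-δ) δ,
        (ε (t + s) * q (t + s) - (ε t * q t + s * Complex.I) : ℂ) ∈ Λ := by
      obtain ⟨δ, hδ, hf, hb⟩ := h.2 t
      refine ⟨δ, hδ, fun s hs => ?_⟩
      rcases le_or_gt 0 s with h0 | h0
      · obtain ⟨e1, e2⟩ := hf s ⟨h0, hs.2⟩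
        rw [e1, e2]
        convert Λ.zero_mem using 1
        push_cast
        linear_combination (s * Complex.I) * hsq t
      · rcases hb with ⟨-, hb⟩ | ⟨c, hc, -, hb⟩
        · obtain ⟨e1, e2⟩ := hb s ⟨hs.1, h0⟩
          rw [e1, e2]
          convert Λ.zero_mem using 1
          push_cast
          linear_combination (s * Complex.I) * hsq t
        · obtain ⟨e1, e2⟩ := hb s ⟨hs.1, h0⟩
          have : (ε (t + s) * q (t + s) - (ε t * q t + s * Complex.I) : ℂ) = -(ε t * (2 * c)) := by
            rw [e1, e2]; push_cast
            linear_combination (s * Complex.I) * hsq t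
          rw [this]
          have h2c : 2 * c ∈ Λ := by rw [two_mul]; exact Λ.add_mem hc hc
          rcases h.1 t with e | e <;> rw [e]
          · simpa using Λ.neg_mem h2c
          · simpa using h2c
    obtain ⟨δ, hδ, key⟩ := key
    filter_upwards [Ioo_mem_nhds (sub_lt_self t hδ) (lt_add_of_pos_right t hδ)] with t' ht'
    have := key (t' - t) ⟨by linarith [ht'.1], by linarith [ht'.2]⟩
    rw [add_sub_cancel] at this
    rw [hv, hv, ← map_sub, ← map_sub, Submodule.mkQ_apply, Submodule.mkQ_apply,
      Submodule.Quotient.eq]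
    convert this using 1
    push_cast; ring
  have := hloc.apply_eq_of_preconnectedSpace (t + u) t
  rw [sub_eq_iff_eq_add] at this
  rw [this, Complex.ofReal_add, add_mul, map_add]
  abel

theorem isClosed_singular : IsClosed F.singular := by
  have : F.singular = F.separator ⁻¹' {0} := by
    ext x; exact (F.separator_eq_zero_iff x).symm
  rw [this]
  exact isClosed_singleton.preimage F.continuous_separator

/-- Without vertical saddle connections, a light ray meets at most one end of a slit. -/
theorem singular_time_unique (hF : ¬ F.HasVerticalSaddleConnection) (h : IsLightRay Λ R q ε)
    {t₀ t₁ : ℝ} (h₀ : F.proj (F.rayLift q ε t₀) ∈ F.singular)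
    (h₁ : F.proj (F.rayLift q ε t₁) ∈ F.singular) : ¬ t₀ < t₁ := by
  intro hlt
  -- The infimum of `S` is the next singular time: it is attained because the singular set is
  -- closed, and exceeds `t₀` because singular times are isolated. The segment in between is a
  -- saddle connection.
  set S := {t | t₀ < t ∧ F.proj (F.rayLift q ε t) ∈ F.singular} with hS
  have hne : S.Nonempty := ⟨t₁, hlt, h₁⟩
  have hbdd : BddBelow S := ⟨t₀, fun t ht => ht.1.le⟩
  have hcont : Continuous fun t => F.proj (F.rayLift q ε t) :=
    F.continuous_proj.comp (continuous_rayLift h)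
  have hmem := csInf_mem_closure hne hbdd
  have hsing : F.proj (F.rayLift q ε (sInf S)) ∈ F.singular :=
    closure_minimal (fun t ht => ht.2) (isClosed_singular.preimage hcont) hmem
  have hlt' : t₀ < sInf S := by
    refine lt_of_le_of_ne (le_csInf hne fun t ht => ht.1.le) fun he => ?_
    rw [← he, mem_closure_iff_frequently] at hmem
    have := eventually_nhdsWithin_iff.1 (eventually_notMem_singular (F := F) h t₀)
    obtain ⟨t, ht, ht'⟩ := (hmem.and_eventually this).exists
    exact ht' ht.1.ne' ht.2
  refine hF ⟨sInf S - t₀, fun u => F.proj (F.rayLift q ε (t₀ + u)), sub_pos.2 hlt', ?_, ?_, ?_, ?_, ?_⟩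
  · exact (hcont.comp (continuous_const.add continuous_id)).continuousOn
  · simpa using h₀
  · simpa using hsing
  · intro u hu hs
    exact notMem_of_lt_csInf (show t₀ + u < sInf S by linarith [hu.2]) hbdd
      ⟨by linarith [hu.1], hs⟩
  · intro u _
    change _ = F.hol (F.proj (F.rayLift q ε (t₀ + 0))) + _
    rw [add_zero]
    exact hol_rayLift h t₀ u

end

end PositiveBasis
end

noncomputable section

open Filter Topology

namespace PositiveBasis

variable {Λ : Submodule ℤ ℂ} {R : ℝ} (F : PositiveBasis Λ R)

/-! ### Time reversal -/

/-- The exchange of the two copies of the plane, on the pieces. -/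
def Piece.swap {F : PositiveBasis Λ R} (a : F.Piece) : F.Piece :=
  ⟨(a.label, !a.sheet, a.half, a.coord), a.2⟩

/-- The exchange of the two copies of the plane, which reverses the vertical flow. -/
def swap : F.Cover → F.Cover :=
  Quot.map Piece.swap (by
    rintro a b (⟨hs, h₁, h₂, hn⟩ | ⟨hs, hm, hh, hc, hp⟩)
    · exact Glue.plane _ _ (congrArg (!·) hs) h₁ h₂ hn
    · exact Glue.cross _ _ (fun h => hs (Bool.not_inj h)) hm hh hc hp)

theorem continuous_swap : Continuous F.swap := by
  refine continuous_quot_lift _ (F.continuous_toCover.comp (Continuous.subtype_mk ?_ _))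
  have h1 := F.continuous_label
  have h2 : Continuous fun a : F.Piece => !a.sheet :=
    (continuous_of_discreteTopology (f := Bool.not)).comp F.continuous_sheet
  have h3 := F.continuous_half
  have h4 := F.continuous_coord
  exact h1.prodMk (h2.prodMk (h3.prodMk h4))

theorem develop_swap (i : Fin 2) (x : F.Cover) : F.develop i (F.swap x) = F.develop i x := by
  obtain ⟨a, rfl⟩ := Quot.exists_rep x
  rfl

theorem hol_swap (x : F.Cover) : F.hol (F.proj (F.swap x)) = -F.hol (F.proj x) := by
  obtain ⟨a, rfl⟩ := Quot.exists_rep x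
  change F.hol (F.proj (F.toCover a.swap)) = -F.hol (F.proj (F.toCover a))
  rw [hol_proj_toCover, hol_proj_toCover, ← map_neg, ← neg_mul]
  congr 2
  change sgn (!a.sheet) = -sgn a.sheet
  cases a.sheet <;> simp [sgn]

theorem swap_mem_singular (x : F.Cover) :
    F.proj (F.swap x) ∈ F.singular ↔ F.proj x ∈ F.singular := by
  obtain ⟨a, rfl⟩ := Quot.exists_rep x
  exact (F.proj_toCover_mem_singular a.swap).trans (F.proj_toCover_mem_singular a).symm

/-! ### Bounds along light rays -/

section

variable {F} {a b C : ℝ}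

/-- The orbit from any later time `s > t₀` is regular, so the hypothesis applies to it. The starting
time `t₀` may be singular and is reached by letting `s` decrease to `t₀`. -/
theorem develop_bound_of_lt
    (hbound : ∀ x ∈ F.forwardRegular, ∀ t > 0,
      ∃ σ, F.IsOrbitClass x t σ ∧ |F.inter σ (a • F.class₁ + b • F.class₂)| ≤ C)
    {e : ℝ → F.Cover} (he : Continuous e)
    (hhol : ∀ t u : ℝ, F.hol (F.proj (e (t + u))) = F.hol (F.proj (e t)) + Λ.mkQ (u * Complex.I))
    {t₀ : ℝ} (hreg : ∀ t, t₀ < t → F.proj (e t) ∉ F.singular) {t : ℝ} (ht : t₀ < t) :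
    |(b * F.develop 0 (e t) - a * F.develop 1 (e t)) -
      (b * F.develop 0 (e t₀) - a * F.develop 1 (e t₀))| ≤ C + |a| + |b| := by
  have hs : ∀ s, t₀ < s → s < t → |(b * F.develop 0 (e t) - a * F.develop 1 (e t)) -
      (b * F.develop 0 (e s) - a * F.develop 1 (e s))| ≤ C + |a| + |b| := by
    intro s hs hst
    have hc : Continuous fun u => e (s + u) := by fun_prop
    have := F.exists_develop_bound hbound (e := fun u => e (s + u)) hc.continuousOn
      ⟨(F.continuous_proj.comp hc).continuousOn, fun u hu => hreg _ (by
        have : (0 : ℝ) ≤ u := hu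
        linarith), fun u _ => by
        change F.hol (F.proj (e (s + u))) = F.hol (F.proj (e (s + 0))) + _
        rw [add_zero]
        exact hhol s u⟩ (sub_pos.2 hst)
    simpa using this
  have hcont : Continuous fun s => |(b * F.develop 0 (e t) - a * F.develop 1 (e t)) -
      (b * F.develop 0 (e s) - a * F.develop 1 (e s))| := by fun_prop
  refine le_of_tendsto (hcont.continuousWithinAt (s := Set.Ioi t₀)) ?_
  filter_upwards [Ioo_mem_nhdsGT ht] with s hs'
  exact hs s hs'.1 hs'.2

/-- For times before `t₀`, exchanging the copies and reversing time gives a curve with upward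
holonomy again, and `develop` is unchanged. -/
theorem develop_bound_of_ne
    (hbound : ∀ x ∈ F.forwardRegular, ∀ t > 0,
      ∃ σ, F.IsOrbitClass x t σ ∧ |F.inter σ (a • F.class₁ + b • F.class₂)| ≤ C)
    {e : ℝ → F.Cover} (he : Continuous e)
    (hhol : ∀ t u : ℝ, F.hol (F.proj (e (t + u))) = F.hol (F.proj (e t)) + Λ.mkQ (u * Complex.I))
    {t₀ : ℝ} (hreg : ∀ t ≠ t₀, F.proj (e t) ∉ F.singular) {t : ℝ} (ht : t ≠ t₀) :
    |(b * F.develop 0 (e t) - a * F.develop 1 (e t)) -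
      (b * F.develop 0 (e t₀) - a * F.develop 1 (e t₀))| ≤ C + |a| + |b| := by
  rcases ht.lt_or_gt with h | h
  · have := develop_bound_of_lt hbound (e := fun u => F.swap (e (-u))) (t₀ := -t₀) (t := -t)
      (F.continuous_swap.comp (he.comp continuous_neg))
      (fun t u => by
        rw [hol_swap, hol_swap, neg_add, hhol (-t) (-u), neg_add, ← map_neg]
        congr 2
        push_cast; ring)
      (fun s hs => by
        rw [swap_mem_singular]
        exact hreg _ (by linarith : -s < t₀).ne)
      (neg_lt_neg h)
    simpa only [neg_neg, develop_swap] using this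
  · exact develop_bound_of_lt hbound he hhol (fun s hs => hreg s hs.ne') h

variable {q : ℝ → ℂ} {ε : ℝ → ℝ}

theorem exists_base_time (hF : ¬ F.HasVerticalSaddleConnection) (h : IsLightRay Λ R q ε) :
    ∃ t₀, ∀ t ≠ t₀, F.proj (F.rayLift q ε t) ∉ F.singular := by
  by_cases hs : ∃ t₀, F.proj (F.rayLift q ε t₀) ∈ F.singular
  · obtain ⟨t₀, h₀⟩ := hs
    refine ⟨t₀, fun t ht h₁ => ?_⟩
    rcases ht.lt_or_gt with hlt | hlt
    · exact singular_time_unique hF h h₁ h₀ hlt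
    · exact singular_time_unique hF h h₀ h₁ hlt
  -- A ray without singular times can be based anywhere; `0` is an arbitrary choice.
  · push Not at hs
    exact ⟨0, fun t _ => hs t⟩

theorem abs_develop_rayLift_sub_le (i : Fin 2) (t : ℝ) :
    |F.develop i (F.rayLift q ε t) - vec (F.coords (q t)) i| ≤ 1 := by
  obtain ⟨-, h, -⟩ := (F.exists_piece (dirSheet (ε t)) (q t)).choose_spec
  have := F.abs_develop_sub_le i (F.exists_piece (dirSheet (ε t)) (q t)).choose
  rwa [h] at this

/-- The transverse coordinate of a light ray stays bounded. -/
theorem exists_transverse_bound (hF : ¬ F.HasVerticalSaddleConnection)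
    (hC : 0 ≤ C)
    (hbound : ∀ x ∈ F.forwardRegular, ∀ t > 0,
      ∃ σ, F.IsOrbitClass x t σ ∧ |F.inter σ (a • F.class₁ + b • F.class₂)| ≤ C)
    (h : IsLightRay Λ R q ε) :
    ∃ p, ∀ t, |b * (F.coords (q t - p)).1 - a * (F.coords (q t - p)).2| ≤
      C + 3 * |a| + 3 * |b| := by
  obtain ⟨t₀, h₀⟩ := exists_base_time hF h
  refine ⟨q t₀, fun t => ?_⟩
  by_cases ht : t = t₀
  · rw [ht, sub_self]
    have : F.coords 0 = 0 := by simp [coords]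
    rw [this]
    simp only [Prod.fst_zero, Prod.snd_zero, mul_zero, sub_zero, abs_zero]
    positivity
  · have hd := develop_bound_of_ne hbound (continuous_rayLift h) (hol_rayLift h) h₀ ht
    -- Passing from `develop` to the true coordinates costs `|a| + |b|` at each of the times `t` and
    -- `t₀`, which raises `C + |a| + |b|` to `C + 3|a| + 3|b|`.
    have key : ∀ (r : ℝ) (i : Fin 2) (t : ℝ),
        |r * F.develop i (F.rayLift q ε t) - r * vec (F.coords (q t)) i| ≤ |r| := fun r i t => by
      rw [← mul_sub, abs_mul]
      exact mul_le_of_le_one_right (abs_nonneg r) (abs_develop_rayLift_sub_le i t)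
    have hsub : F.coords (q t - q t₀) = F.coords (q t) - F.coords (q t₀) := by
      rw [eq_sub_iff_add_eq, ← coords_add, sub_add_cancel]
    have k1 := abs_le.1 (key b 0 t)
    have k2 := abs_le.1 (key b 0 t₀)
    have k3 := abs_le.1 (key a 1 t)
    have k4 := abs_le.1 (key a 1 t₀)
    simp only [vec, Matrix.cons_val_zero, Matrix.cons_val_one] at k1 k2 k3 k4
    rw [hsub, Prod.fst_sub, Prod.snd_sub]
    rw [abs_le] at hd ⊢
    constructor <;> linarith [hd.1, hd.2, k1.1, k1.2, k2.1, k2.2, k3.1, k3.2, k4.1, k4.2]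

/-- A bound of the transverse coordinate confines a point to a band. -/
theorem mem_band_of_transverse_le {z p : ℂ} {K : ℝ} (hab : 0 < a ^ 2 + b ^ 2)
    (h : |b * (F.coords (z - p)).1 - a * (F.coords (z - p)).2| ≤ K) :
    z ∈ band p (F.pos (-2 * (a, b))) (2 * (K / (a ^ 2 + b ^ 2) * ‖F.pos (b, -a)‖)) := by
  set d := F.coords (z - p) with hd
  have hz : z = p + F.pos d := by rw [hd, F.pos_coords]; ring
  -- In coordinates `d = r (a, b) + m (b, -a)`: the first term runs along the band, and the second
  -- is controlled by `K`. The parameter `-r / 2` used below compensates the factor `-2` of the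
  -- direction vector.
  set r := (a * d.1 + b * d.2) / (a ^ 2 + b ^ 2) with hr
  set m := (b * d.1 - a * d.2) / (a ^ 2 + b ^ 2) with hm
  have h1 : a * r + b * m = d.1 := by rw [hr, hm]; field_simp; ring
  have h2 : b * r - a * m = d.2 := by rw [hr, hm]; field_simp; ring
  have hdist : z - (p + ((-r / 2 : ℝ) : ℂ) * F.pos (-2 * (a, b))) = m * F.pos (b, -a) := by
    rw [hz]
    simp only [pos, ← h1, ← h2]
    simp
    ring
  have hmem : p + ((-r / 2 : ℝ) : ℂ) * F.pos (-2 * (a, b)) ∈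
      Set.range fun r : ℝ => p + (r : ℂ) * F.pos (-2 * (a, b)) := ⟨-r / 2, rfl⟩
  change Metric.infDist _ _ ≤ _
  refine (Metric.infDist_le_dist_of_mem hmem).trans ?_
  rw [dist_eq_norm, hdist, norm_mul, Complex.norm_real, Real.norm_eq_abs, hm, abs_div,
    abs_of_pos hab, mul_div_cancel_left₀ _ two_ne_zero]
  gcongr

end

end PositiveBasis
end

/-! ### The theorem -/

theorem theorem3p2 (Λ : Submodule ℤ ℂ) [DiscreteTopology Λ] [IsZLattice ℝ Λ]
    (hΛ : ZLattice.covolume Λ = 1) (R : ℝ) (hR : 0 < R)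
    (hdisj : ∀ c ∈ Λ, ∀ c' ∈ Λ, c ≠ c' → Disjoint (slit R c) (slit R c'))
    (F : PositiveBasis Λ R)
    (hsaddle : ¬ F.HasVerticalSaddleConnection)
    (ξ : H1 F.Surface) (hξ₀ : ξ ≠ 0) (hξ : ξ ∈ Submodule.span ℝ {F.class₁, F.class₂})
    (hbound : ∃ C > 0, ∀ x ∈ F.forwardRegular, ∀ t > 0,
      ∃ σ, F.IsOrbitClass x t σ ∧ |F.inter σ ξ| ≤ C) :
    F.bandDirection ξ ≠ 0 ∧
      ∃ C' > 0, ∀ q ε, IsLightRay Λ R q ε →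
        ∃ p : ℂ, ∀ t, q t ∈ band p (F.bandDirection ξ) C' := by
  obtain ⟨a, b, rfl⟩ := Submodule.mem_span_pair.1 hξ
  obtain ⟨C, hC, hbound⟩ := hbound
  -- Only this consequence of `ξ ≠ 0` matters: it makes `v̄` non-zero, since `γ₊, γ₋` are
  -- independent, and allows division by `a² + b²`.
  have hab : a ≠ 0 ∨ b ≠ 0 := by
    by_contra hc
    push Not at hc
    exact hξ₀ (by simp [hc.1, hc.2])
  have hab' : 0 < a ^ 2 + b ^ 2 := by
    rcases hab with h | h <;> positivity
  have hpos : ∀ y : ℝ × ℝ, y ≠ 0 → F.pos y ≠ 0 := fun y hy h0 =>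
    hy (F.pos_injective (h0.trans (by simp [PositiveBasis.pos])))
  rw [F.bandDirection_combination]
  refine ⟨hpos _ fun h => ?_, 2 * ((C + 3 * |a| + 3 * |b|) / (a ^ 2 + b ^ 2) *
    ‖F.pos (b, -a)‖), ?_, fun q ε h => ?_⟩
  · rcases hab with h' | h'
    · exact h' (by simpa using congrArg Prod.fst h)
    · exact h' (by simpa using congrArg Prod.snd h)
  · have h2 : 0 < ‖F.pos (b, -a)‖ := norm_pos_iff.2 (hpos _ fun h => by
      rcases hab with h' | h'
      · exact h' (by simpa using congrArg Prod.snd h)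
      · exact h' (by simpa using congrArg Prod.fst h))
    positivity
  · obtain ⟨p, hp⟩ := PositiveBasis.exists_transverse_bound hsaddle hC.le hbound h
    exact ⟨p, fun t => PositiveBasis.mem_band_of_transverse_le hab' (hp t)⟩
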